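/- Throughout, $k>\ell\ge 2$, $t\ge 0$ and $n$ are integers. An $\ell$-graph $G$ consists of a finite vertex set $V(G)$ and a set $E(G)$ of $\ell$-element subsets of $V(G)$. A set $S\subseteq V(G)$ with $|S|=s$ induces (a copy of) $K_s^\ell$ in $G$ if every $\ell$-subset of $S$ is an edge. Call $G$ *extremal* (for $k,\ell,t,n$) if $|V(G)|=n$, every vertex of $G$ lies in at least $\binom{t}{k-1}$ copies of $K_k^\ell$, and $G$ has the minimum number of edges among all $\ell$-graphs on $n$ vertices with this property. The antilexicographic order on $r$-subsets of a linearly ordered set is: $S<T$ iff $\max(S\setminus T)<\max(T\setminus S)$. For $Y,S\subseteq V(G)$ disjoint with $|Y|<\ell$ let $L_G^Y(S)=\{A\subseteq S: |A|=\ell-|Y|,\ A\cup Y\in E(G)\}$. **The transformation.** Let $V=V(G)$, let $A_1=\{v_1,\dots,v_{t+1}\}$ and $A_2$ both induce $K_{t+1}^\ell$ in $G$, let $C=\{v_{t+2},\dots,v_{2(t+1)}\}$ be a set of $t+1$ new vertices, and let $B$ be the set of vertices of $V\setminus(A_1\cup A_2)$ that lie in a common edge with some vertex of $A_1\cup A_2$.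 Let $G'$ be the $\ell$-graph on $V\cup C$ whose edges are: the edges of $G$ contained in $A_1$, in $A_2$, or in $V\setminus (A_1\cup A_2)$; and, for every $Y\subseteq B$ with $0<|Y|\le \ell-1$, the sets $Y\cup S$, where $S$ runs over the $|L_G^Y(A_1\cup A_2)|$ smallest $(\ell-|Y|)$-subsets of $A_1\cup C=\{v_1,\dots,v_{2(t+1)}\}$ in the antilexicographic order. For vertices $i\ne j$ of an $\ell$-graph $H$, the shift $S_{i,j}(H)$ is obtained by replacing, simultaneously, each edge $e$ with $j\in e$, $i\notin e$ and $(e\cup\{i\})\setminus\{j\}\notin E(H)$ by $(e\cup\{i\})\setminus\{j\}$. Enumerate $V\setminus(A_2\setminus A_1)$ as $x_1,\dots,x_N$ and $C$ as $c_1,\dots,c_{t+1}$, put $G_0=G'$ and $G_i=S_{x_i,c_1}(S_{x_i,c_2}(\cdots S_{x_i,c_{t+1}}(G_{i-1})\cdots))$ for $1\le i\le N$. Then $\mathcal G(G,A_1,A_2)$ is the subgraph of $G_N$ induced on $V$. **Lemma.** For all integers $k>\ell\ge2$ there is $t_0=t_0(k,\ell)$ such that the following holds for all integers $t\ge 0$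 and $n$. Let $G$ be an extremal $\ell$-graph on $n$ vertices and let $A_1=\{v_1,\dots,v_{t+1}\}$ and $A_2$ both induce $K_{t+1}^\ell$ in $G$. Then, for every choice of the labelling of $A_1$ and of the two enumerations, $G''=\mathcal G(G,A_1,A_2)$ satisfies: 1. $V(G'')=V(G)$. 2. $|E(G'')|\le|E(G)|$. 3. Both $A_1$ and $A_2$ induce $K_{t+1}^\ell$ in $G''$, and every edge $e\in E(G'')$ with $e\cap(A_2\setminus A_1)\neq\emptyset$ satisfies $e\subseteq A_2$. 4. For every $A_3$ that induces $K_{t+1}^\ell$ in $G$, the set $(A_3\setminus(A_1\cup A_2))\cup\{v_1,\dots,v_m\}$, where $m=|A_3\cap(A_1\cup A_2)|$, induces $K_{t+1}^\ell$ in $G''$. 5. If $t\ge t_0$ and $n>\frac14(t+1)^2\binom{t-1}{\ell-2}+2t$, then every vertex of $G''$ lies in at least $\binom{t}{k-1}$ copies of $K_k^\ell$ in $G''$. -/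

import Mathlib

/-- An `ℓ`-uniform hypergraph (`ℓ`-graph) with finite vertex set `verts ⊆ α`. -/
structure UGraph (α : Type*) (ℓ : ℕ) where
  verts : Finset α
  edges : Finset (Finset α)
  subset_verts : ∀ e ∈ edges, e ⊆ verts
  card_eq : ∀ e ∈ edges, e.card = ℓ

namespace UGraph

variable {α : Type*} [DecidableEq α] {ℓ : ℕ}

/-- `S` induces a copy of `K_s^ℓ` in `G`: it consists of `s` vertices, and each of its
`ℓ`-subsets is an edge. -/
def InducesK (G : UGraph α ℓ) (s : ℕ) (S : Finset α) : Prop :=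
  S ⊆ G.verts ∧ S.card = s ∧ S.powersetCard ℓ ⊆ G.edges

open Classical in
/-- The number of copies of `K_k^ℓ` in `G` that contain the vertex `u`. -/
noncomputable def numCopies (G : UGraph α ℓ) (k : ℕ) (u : α) : ℕ :=
  (G.verts.powerset.filter fun S => u ∈ S ∧ G.InducesK k S).card

/-- Every vertex lies in at least `C(t, k-1)` copies of `K_k^ℓ`. -/
def CliqueCondition (G : UGraph α ℓ) (k t : ℕ) : Prop :=
  ∀ u ∈ G.verts, t.choose (k - 1) ≤ G.numCopies k u

/-- `G` has the fewest edges among the `ℓ`-graphs on `n` vertices all of whose vertices lie in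
at least `C(t, k-1)` copies of `K_k^ℓ`. -/
def IsExtremal (G : UGraph α ℓ) (k t n : ℕ) : Prop :=
  G.verts.card = n ∧ G.CliqueCondition k t ∧
    ∀ H : UGraph α ℓ, H.verts.card = n → H.CliqueCondition k t → G.edges.card ≤ H.edges.card

/-- `v` is a neighbour of `u`. -/
def IsNeighbor (G : UGraph α ℓ) (u v : α) : Prop :=
  v ≠ u ∧ ∃ e ∈ G.edges, u ∈ e ∧ v ∈ e

/-- The edge set of the link of `Y` restricted to `S`, an `(ℓ - |Y|)`-graph on `S`. -/
def link (G : UGraph α ℓ) (Y S : Finset α) : Finset (Finset α) :=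
  (S.powersetCard (ℓ - Y.card)).filter fun A => A ∪ Y ∈ G.edges

open Classical in
/-- The set `B` of the vertices outside `A₁ ∪ A₂` that have a neighbour in `A₁ ∪ A₂`. -/
noncomputable def boundary (G : UGraph α ℓ) (A₁ A₂ : Finset α) : Finset α :=
  (G.verts \ (A₁ ∪ A₂)).filter fun u => ∃ w ∈ A₁ ∪ A₂, G.IsNeighbor u w

end UGraph

/-- The `m` smallest `r`-subsets of `Fin N` in the antilexicographic order (on sets of equal size
this is Mathlib's colexicographic order): those with fewer than `m` predecessors. -/
def smallestSets (N r m : ℕ) : Finset (Finset (Fin N)) :=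
  (Finset.univ.powersetCard r).filter fun A =>
    ((Finset.univ.powersetCard r).filter fun B : Finset (Fin N) => toColex B < toColex A).card < m

/-- The list `l` enumerates the finite set `S`, without repetition. -/
def Enumerates {γ : Type*} (l : List γ) (S : Finset γ) : Prop :=
  l.Nodup ∧ ∀ x, x ∈ l ↔ x ∈ S

/-- The shift `S_{i,j}(e)` of a single member `e` of the family `E`. -/
def shiftEdge {β : Type*} [DecidableEq β] (E : Finset (Finset β)) (i j : β) (e : Finset β) :
    Finset β :=
  if j ∈ e ∧ i ∉ e ∧ (e ∪ {i}) \ {j} ∉ E then (e ∪ {i}) \ {j} else e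

/-- The shifted family `S_{i,j}(E)`. -/
def shiftFamily {β : Type*} [DecidableEq β] (i j : β) (E : Finset (Finset β)) :
    Finset (Finset β) :=
  E.image (shiftEdge E i j)

namespace UGraph

variable {α : Type*} [DecidableEq α] {ℓ t : ℕ}

/-- The labelling `v_1, …, v_{2(t+1)}` of `A₁ ∪ C`: the first `t+1` labels are given to the
vertices of `A₁` by `v`, the last `t+1` to the new vertices `C = Fin (t+1)`. -/
def label (v : Fin (t + 1) ↪ α) : Fin ((t + 1) + (t + 1)) ↪ α ⊕ Fin (t + 1) :=
  finSumFinEquiv.symm.toEmbedding.trans (v.sumMap (Function.Embedding.refl _))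

open Classical in
/-- The edge set of the auxiliary `ℓ`-graph `G'` on the vertex set `V ∪ C`. An edge of `G'` is
either an edge of `G` inside `A₁`, inside `A₂` or outside `A₁ ∪ A₂`; or it is `Y ∪ S` where
`Y ⊆ B`, `0 < |Y| ≤ ℓ - 1`, and `S` is one of the `|L_G^Y(A₁ ∪ A₂)|` smallest
`(ℓ - |Y|)`-subsets of `A₁ ∪ C = {v_1, …, v_{2(t+1)}}`. -/
noncomputable def auxEdges (G : UGraph α ℓ) (A₁ A₂ : Finset α) (v : Fin (t + 1) ↪ α) :
    Finset (Finset (α ⊕ Fin (t + 1))) :=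
  (G.edges.filter fun e => e ⊆ A₁ ∨ e ⊆ A₂ ∨ Disjoint e (A₁ ∪ A₂)).image
      (fun e => e.map Function.Embedding.inl) ∪
    ((G.boundary A₁ A₂).powerset.filter fun Y => 0 < Y.card ∧ Y.card ≤ ℓ - 1).biUnion fun Y =>
      (smallestSets ((t + 1) + (t + 1)) (ℓ - Y.card) (G.link Y (A₁ ∪ A₂)).card).image fun S =>
        Y.map Function.Embedding.inl ∪ S.map (label v)

/-- `G_i` from `G_{i-1}`: with `C` enumerated as `c_1, …, c_{t+1}` by `cs`, this is
`S_{i,c_1}(S_{i,c_2}(⋯ S_{i,c_{t+1}}(E)))`. -/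
def shiftInto (cs : List (Fin (t + 1))) (E : Finset (Finset (α ⊕ Fin (t + 1)))) (i : α) :
    Finset (Finset (α ⊕ Fin (t + 1))) :=
  cs.foldr (fun c F => shiftFamily (Sum.inl i) (Sum.inr c) F) E

/-- The edge set of the last `ℓ`-graph of the sequence `G_0 = G', G_1, G_2, …`, where `G_i` is
obtained by shifting all of `C` into the `i`-th vertex of the list `xs`. -/
noncomputable def shiftedEdges (G : UGraph α ℓ) (A₁ A₂ : Finset α) (v : Fin (t + 1) ↪ α)
    (xs : List α) (cs : List (Fin (t + 1))) : Finset (Finset (α ⊕ Fin (t + 1))) :=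
  xs.foldl (shiftInto cs) (G.auxEdges A₁ A₂ v)

/-- The transformed `ℓ`-graph `𝒢(G, A₁, A₂)`: the subgraph induced on `V` by the last graph of
the shifting sequence. It depends on the labelling `v` of `A₁` and on the orders `xs` of
`V \ (A₂ \ A₁)` and `cs` of `C` used in the shifting sequence. -/
noncomputable def transform (G : UGraph α ℓ) (A₁ A₂ : Finset α) (v : Fin (t + 1) ↪ α)
    (xs : List α) (cs : List (Fin (t + 1))) : UGraph α ℓ where
  verts := G.verts
  edges := (G.verts.powersetCard ℓ).filter fun e =>
    e.map Function.Embedding.inl ∈ G.shiftedEdges A₁ A₂ v xs cs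
  subset_verts := fun _ he => (Finset.mem_powersetCard.1 (Finset.mem_filter.1 he).1).1
  card_eq := fun _ he => (Finset.mem_powersetCard.1 (Finset.mem_filter.1 he).1).2

end UGraph

/-- The set `{v_1, …, v_m}` of the first `m` vertices of the labelling `v`. -/
def firstVertices {α : Type*} {t : ℕ} (v : Fin (t + 1) ↪ α) (m : ℕ) : Finset α :=
  (Finset.univ.filter fun i : Fin (t + 1) => i.val < m).map v

/-! Write `A = A₁ ∪ A₂`. The auxiliary graph compresses the link of each boundary set `Y` to an
initial segment of the colex order on `A₁ ∪ C`. Each compressed edge is paid for by an edge of `G`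
with the same trace outside `A`, and shifts preserve the number of edges; this gives (2). An edge
without vertices of `C` never moves under the shifts, so `A₁`, `A₂` and the compressed copies of
other cliques persist. Nothing is ever shifted into `A₂ \ A₁`, so its vertices keep only edges
inside `A₂`.

For (5), group the `k`-cliques at a vertex `a ∉ A` by their trace `Y` outside `A`, and replace the
`m` sets extending `Y` by the `m` smallest label sets of the same size. Kruskal–Katona
(`mixed_mem_auxEdges`) supplies all edges between `Y` and the new sets. Edges inside the new sets
are present if these lie in `A₁`, which holds when `m ≤ C(t+1, k-|Y|)`. If this bound fails for some
relevant `Y`, then `a` is joined completely to `A₁` (`hasAllSubsets_insert`) and has enough cliques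
anyway. Shifting into `V` does not lower the clique counts at vertices of `V`.

It remains to exclude edges meeting `C` (`inr_notMem_of_mem_shiftedEdges`). If `c ∈ C` lies in a
final edge, then `c` can be replaced by almost any vertex of `V`, so the other vertices of that edge
have degree close to `n`. All vertices of `V` have degree at least `C(t, ℓ-1)`, by the Lovász form
of Kruskal–Katona. Comparing `G` with an almost disjoint union of cliques (`IsExtremal.edges_le`)
bounds the degree sum by `n C(t, ℓ-1) + (t+1)² C(t-1, ℓ-2) / 4`, which leaves no room for such
degrees. -/

/-! ### Shifts: edge counts, closure under replacement, clique counts. -/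

section Shift

variable {β : Type*} [DecidableEq β]

theorem shiftEdge_injOn (E : Finset (Finset β)) {i j : β} (hij : i ≠ j) :
    Set.InjOn (shiftEdge E i j) E := by
  intro e he e' he' h
  have he : e ∈ E := he
  have he' : e' ∈ E := he'
  unfold shiftEdge at h
  split_ifs at h with h1 h2 h2
  · ext a
    have := Finset.ext_iff.1 h a
    simp only [Finset.mem_sdiff, Finset.mem_union, Finset.mem_singleton] at this
    by_cases ha : a = i
    · subst ha; simp [h1.2.1, h2.2.1]
    · by_cases hb : a = j
      · subst hb; simp [h1.1, h2.1]
      · simpa [ha, hb] using this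
  · exact absurd (h ▸ he') h1.2.2
  · exact absurd (h ▸ he) h2.2.2
  · exact h

theorem card_shiftFamily (E : Finset (Finset β)) {i j : β} (hij : i ≠ j) :
    (shiftFamily i j E).card = E.card :=
  Finset.card_image_of_injOn (shiftEdge_injOn E hij)

theorem replace_replace {i j : β} {e : Finset β} (hij : i ≠ j) (hj : j ∈ e) (hi : i ∉ e) :
    ((e ∪ {i}) \ {j} ∪ {j}) \ {i} = e := by
  ext a
  simp only [Finset.mem_sdiff, Finset.mem_union, Finset.mem_singleton]
  grind

theorem mem_shiftFamily {E : Finset (Finset β)} {i j : β} (hij : i ≠ j) {e : Finset β} :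
    e ∈ shiftFamily i j E ↔ (e ∈ E ∧ (j ∈ e → i ∉ e → (e ∪ {i}) \ {j} ∈ E)) ∨
      (i ∈ e ∧ j ∉ e ∧ (e ∪ {j}) \ {i} ∈ E) := by
  unfold shiftFamily
  rw [Finset.mem_image]
  constructor
  · rintro ⟨f, hf, rfl⟩
    unfold shiftEdge
    split_ifs with h
    · right
      refine ⟨by simp [hij], by simp, ?_⟩
      rwa [replace_replace hij h.1 h.2.1]
    · left
      refine ⟨hf, fun h1 h2 => ?_⟩
      by_contra h3
      exact h ⟨h1, h2, h3⟩
  · rintro (⟨h1, h2⟩ | ⟨h1, h2, h3⟩)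
    · refine ⟨e, h1, ?_⟩
      unfold shiftEdge
      rw [if_neg]
      rintro ⟨h3, h4, h5⟩
      exact h5 (h2 h3 h4)
    · by_cases he : e ∈ E
      · refine ⟨e, he, ?_⟩
        unfold shiftEdge
        rw [if_neg]
        exact fun h => h2 h.1
      · refine ⟨(e ∪ {j}) \ {i}, h3, ?_⟩
        have := replace_replace hij.symm h1 h2
        unfold shiftEdge
        rw [this, if_pos]
        exact ⟨by simp [hij.symm], by simp, he⟩

theorem mem_shiftFamily_of_notMem {E : Finset (Finset β)} {i j : β} (hij : i ≠ j) {e : Finset β}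
    (he : e ∈ E) (hj : j ∉ e) : e ∈ shiftFamily i j E :=
  (mem_shiftFamily hij).2 (Or.inl ⟨he, fun h => absurd h hj⟩)

/-- In `F`, the vertex `c` can be replaced by `x` in every member containing `c` but not `x`. -/
def ClosedUnder (x c : β) (F : Finset (Finset β)) : Prop :=
  ∀ f : Finset β, x ∉ f → c ∉ f → insert c f ∈ F → insert x f ∈ F

theorem closedUnder_shiftFamily {x c : β} (hxc : x ≠ c) (F : Finset (Finset β)) :
    ClosedUnder x c (shiftFamily x c F) := by
  intro f hx hc hf
  have h : (insert c f ∪ {x}) \ {c} = insert x f := by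
    ext a
    simp only [Finset.mem_sdiff, Finset.mem_union, Finset.mem_singleton, Finset.mem_insert]
    grind
  rcases (mem_shiftFamily hxc).1 hf with ⟨_, h2⟩ | ⟨h1, _, _⟩
  · refine mem_shiftFamily_of_notMem hxc ?_ (by simp [hc, hxc.symm])
    rw [← h]
    exact h2 (by simp) (by simp [hx, hxc])
  · exact absurd h1 (by simp [hx, hxc])

theorem insert_union_sdiff {a i j : β} {f : Finset β} (haj : a ≠ j) :
    (insert a f ∪ {i}) \ {j} = insert a ((f ∪ {i}) \ {j}) := by
  ext b
  simp only [Finset.mem_sdiff, Finset.mem_union, Finset.mem_singleton, Finset.mem_insert]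
  grind

/-- Later shifts do not destroy closure achieved earlier, because no vertex is both a source and a
target. In each case the hypothesis `hF` is applied to `f` or to `f` with `x'` and `c'` exchanged.
-/
theorem ClosedUnder.shiftFamily {x c x' c' : β} {F : Finset (Finset β)} (hF : ClosedUnder x c F)
    (hxc : x ≠ c) (hxc' : x ≠ c') (hx'c : x' ≠ c) (hx'c' : x' ≠ c') :
    ClosedUnder x c (shiftFamily x' c' F) := by
  by_cases hboth : x = x' ∧ c = c'
  · rw [hboth.1, hboth.2]
    exact closedUnder_shiftFamily hx'c' F
  intro f hx hc hf
  rw [mem_shiftFamily hx'c'] at hf ⊢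
  by_cases hc'f : c' ∈ f
  · have hcc' : c ≠ c' := by rintro rfl; exact hc hc'f
    rcases hf with ⟨h1, h2⟩ | ⟨_, h2, _⟩
    · refine Or.inl ⟨hF f hx hc h1, fun _ h4 => ?_⟩
      have h5 : x' ≠ x := by rintro rfl; simp at h4
      have h6 : x' ∉ f := fun h => h4 (by simp [h])
      have := h2 (by simp [hc'f]) (by simp [h6, hx'c])
      rw [insert_union_sdiff hcc'] at this
      rw [insert_union_sdiff hxc']
      exact hF _ (by simp [hx, h5.symm]) (by simp [hc, hx'c.symm]) this
    · simp [hc'f] at h2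
  · by_cases hx'f : x' ∈ f
    · have hxx' : x ≠ x' := by rintro rfl; exact hx hx'f
      rcases hf with ⟨h1, _⟩ | ⟨_, h2, h3⟩
      · exact Or.inl ⟨hF f hx hc h1, fun h => absurd h (by simp [hxc'.symm, hc'f])⟩
      · right
        have hcc' : c ≠ c' := by rintro rfl; simp at h2
        refine ⟨by simp [hx'f], by simp [hxc'.symm, hc'f], ?_⟩
        rw [insert_union_sdiff hx'c.symm] at h3
        rw [insert_union_sdiff hxx']
        exact hF _ (by simp [hx, hxc']) (by simp [hc, hcc']) h3
    · rcases hf with ⟨h1, _⟩ | ⟨h1, _, _⟩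
      · exact Or.inl ⟨hF f hx hc h1, fun h => absurd h (by simp [hxc'.symm, hc'f])⟩
      · simp [hx'f, hx'c] at h1

/-- All `ℓ`-subsets of `S` belong to `F`. -/
def HasAllSubsets (F : Finset (Finset β)) (ℓ : ℕ) (S : Finset β) : Prop :=
  ∀ e ⊆ S, e.card = ℓ → e ∈ F

open Classical in
/-- The `k`-subsets of `U` that are complete in `F` and contain `u`. -/
noncomputable def cliquesAt (F : Finset (Finset β)) (ℓ k : ℕ) (U : Finset β) (u : β) :
    Finset (Finset β) :=
  (U.powersetCard k).filter fun S => u ∈ S ∧ HasAllSubsets F ℓ S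

theorem mem_cliquesAt {F : Finset (Finset β)} {ℓ k : ℕ} {U : Finset β} {u : β} {S : Finset β} :
    S ∈ cliquesAt F ℓ k U u ↔ S ⊆ U ∧ S.card = k ∧ u ∈ S ∧ HasAllSubsets F ℓ S := by
  simp [cliquesAt, and_assoc]

theorem card_replace {i j : β} {e : Finset β} (hj : j ∈ e) (hi : i ∉ e) :
    ((e ∪ {i}) \ {j}).card = e.card := by
  rw [Finset.card_sdiff_of_subset (by simp [hj]), Finset.card_union_of_disjoint (by simp [hi])]
  simp

/-- Shifting the family of `k`-cliques of `F` yields cliques of the shifted family, and this map is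
injective. As `u ≠ c`, the vertex `u` is never removed. -/
theorem card_cliquesAt_le_shiftFamily (F : Finset (Finset β)) (ℓ k : ℕ) {U : Finset β} {u x c : β}
    (hxc : x ≠ c) (huc : u ≠ c) (hx : x ∈ U) :
    (cliquesAt F ℓ k U u).card ≤ (cliquesAt (shiftFamily x c F) ℓ k U u).card := by
  classical
  set 𝒦 := (U.powersetCard k).filter fun S => HasAllSubsets F ℓ S with h𝒦
  have hmem : ∀ S, S ∈ 𝒦 ↔ S ⊆ U ∧ S.card = k ∧ HasAllSubsets F ℓ S := by
    intro S; simp [h𝒦, and_assoc]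
  refine Finset.card_le_card_of_injOn (shiftEdge 𝒦 x c) ?_ ((shiftEdge_injOn 𝒦 hxc).mono ?_)
  swap
  · intro S hS
    have := mem_cliquesAt.1 hS
    exact (hmem S).2 ⟨this.1, this.2.1, this.2.2.2⟩
  intro S hS
  obtain ⟨hSU, hSk, huS, hSc⟩ := mem_cliquesAt.1 hS
  apply mem_cliquesAt.2
  unfold shiftEdge
  split_ifs with h
  · obtain ⟨hcS, hxS, _⟩ := h
    refine ⟨?_, by rw [card_replace hcS hxS, hSk], by simp [huS, huc], ?_⟩
    · intro a ha
      simp only [Finset.mem_sdiff, Finset.mem_union, Finset.mem_singleton] at ha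
      rcases ha.1 with h | rfl
      · exact hSU h
      · exact hx
    · intro e he hel
      have hce : c ∉ e := fun h => by simpa using he h
      by_cases hxe : x ∈ e
      · refine (mem_shiftFamily hxc).2 (Or.inr ⟨hxe, hce, hSc _ ?_ ?_⟩)
        · intro a ha
          simp only [Finset.mem_sdiff, Finset.mem_union, Finset.mem_singleton] at ha
          rcases ha.1 with h | rfl
          · have := he h
            simp only [Finset.mem_sdiff, Finset.mem_union, Finset.mem_singleton] at this
            exact this.1.resolve_right ha.2
          · exact hcS
        · rw [card_replace hxe hce, hel]
      · refine mem_shiftFamily_of_notMem hxc (hSc _ (fun a ha => ?_) hel) hce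
        have := he ha
        simp only [Finset.mem_sdiff, Finset.mem_union, Finset.mem_singleton] at this
        exact this.1.resolve_right (by rintro rfl; exact hxe ha)
  · refine ⟨hSU, hSk, huS, fun e he hel => (mem_shiftFamily hxc).2 (Or.inl ⟨hSc e he hel, ?_⟩)⟩
    intro hce hxe
    have hsub : (e ∪ {x}) \ {c} ⊆ (S ∪ {x}) \ {c} :=
      Finset.sdiff_subset_sdiff (Finset.union_subset_union_left he) subset_rfl
    have hcard := (card_replace hce hxe).trans hel
    by_cases hxS : x ∈ S
    · refine hSc _ (fun a ha => ?_) hcard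
      have := hsub ha
      simp only [Finset.mem_sdiff, Finset.mem_union, Finset.mem_singleton] at this
      rcases this.1 with h | rfl
      · exact h
      · exact hxS
    -- The clique `S` stayed in place only because its replacement is already a clique, so the
    -- replacements of its edges already lie in `F`.
    · have : (S ∪ {x}) \ {c} ∈ 𝒦 := by
        by_contra h'
        exact h ⟨he hce, hxS, h'⟩
      exact ((hmem _).1 this).2.2 _ hsub hcard

end Shift

/-! ### Initial segments of the colex order and Kruskal–Katona. -/

section
variable {N r m : ℕ}

theorem mem_smallestSets {A : Finset (Fin N)} : A ∈ smallestSets N r m ↔ A.card = r ∧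
    ((Finset.univ.powersetCard r).filter fun B : Finset (Fin N) =>
      toColex B < toColex A).card < m := by
  simp [smallestSets]

/-- Colex is a linear order, so the number of predecessors is a bijection from the `r`-sets onto
`{0, …, C(N,r) - 1}`. -/
theorem card_smallestSets (N r m : ℕ) : (smallestSets N r m).card = min m (N.choose r) := by
  set P := (Finset.univ : Finset (Fin N)).powersetCard r with hP
  have hPc : P.card = N.choose r := by simp [hP]
  set rank : Finset (Fin N) → ℕ := fun A => (P.filter fun B => toColex B < toColex A).card
    with hrank
  have hlt : ∀ A ∈ P, ∀ B : Finset (Fin N), toColex A < toColex B → rank A < rank B := by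
    intro A hA B hAB
    apply Finset.card_lt_card
    refine ⟨fun C hC => ?_, fun h => ?_⟩
    · simp only [Finset.mem_filter] at hC ⊢
      exact ⟨hC.1, hC.2.trans hAB⟩
    · have : A ∈ P.filter fun B => toColex B < toColex A := h (by simp [hA, hAB])
      simp at this
  have hinj : Set.InjOn rank P := by
    intro A hA B hB h
    rcases lt_trichotomy (toColex A) (toColex B) with h' | h' | h'
    · exact absurd h (hlt A hA B h').ne
    · exact toColex.injective h'
    · exact absurd h (hlt B hB A h').ne'
  have himg : P.image rank = Finset.range (N.choose r) := by
    apply Finset.eq_of_subset_of_card_le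
    · intro a ha
      obtain ⟨A, hA, rfl⟩ := Finset.mem_image.1 ha
      rw [Finset.mem_range, ← hPc]
      apply Finset.card_lt_card
      refine ⟨Finset.filter_subset _ _, fun h => ?_⟩
      have := h hA
      simp at this
    · rw [Finset.card_image_of_injOn hinj, hPc, Finset.card_range]
  have h1 : smallestSets N r m = P.filter fun A => rank A < m := rfl
  have h2 : (P.filter fun A => rank A < m).image rank =
      Finset.range (min m (N.choose r)) := by
    ext a
    have := Finset.ext_iff.1 himg a
    simp only [Finset.mem_image, Finset.mem_range, Finset.mem_filter, lt_min_iff] at this ⊢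
    rw [← this]
    constructor
    · rintro ⟨A, ⟨h, h'⟩, rfl⟩
      exact ⟨h', A, h, rfl⟩
    · rintro ⟨h', A, h, rfl⟩
      exact ⟨A, ⟨h, h'⟩, rfl⟩
  rw [h1, ← Finset.card_image_of_injOn (hinj.mono (Finset.coe_subset.2 (Finset.filter_subset _ _))),
    h2, Finset.card_range]

theorem smallestSets_isInitSeg (N r m : ℕ) : Finset.Colex.IsInitSeg (smallestSets N r m) r := by
  constructor
  · intro A hA
    exact (mem_smallestSets.1 hA).1
  · intro A B hA hB
    rw [mem_smallestSets] at hA ⊢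
    refine ⟨hB.2, lt_of_le_of_lt (Finset.card_le_card fun C hC => ?_) hA.2⟩
    simp only [Finset.mem_filter] at hC ⊢
    exact ⟨hC.1, hC.2.trans hB.1⟩

theorem subset_smallestSets_of_isInitSeg {𝒞 : Finset (Finset (Fin N))}
    (h : Finset.Colex.IsInitSeg 𝒞 r) (hm : 𝒞.card ≤ m) : 𝒞 ⊆ smallestSets N r m := by
  intro A hA
  rw [mem_smallestSets]
  refine ⟨h.1 hA, lt_of_lt_of_le (Finset.card_lt_card ⟨fun B hB => ?_, fun h' => ?_⟩) hm⟩
  · simp only [Finset.mem_filter, Finset.mem_powersetCard] at hB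
    exact h.2 hA ⟨hB.2, hB.1.2⟩
  · have := h' hA
    simp at this

/-- Sets of first labels come early. -/
theorem mem_smallestSets_of_lt {s : ℕ} {T : Finset (Fin N)} (hT : T.card = r)
    (hs : ∀ i ∈ T, i.val < s) (hm : s.choose r ≤ m) : T ∈ smallestSets N r m := by
  rw [mem_smallestSets]
  refine ⟨hT, lt_of_lt_of_le ?_ hm⟩
  set Q := ((Finset.univ : Finset (Fin N)).filter fun i => i.val < s).powersetCard r with hQ
  have hQc : Q.card ≤ s.choose r := by
    rw [hQ, Finset.card_powersetCard]
    apply Nat.choose_le_choose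
    calc _ ≤ (Finset.range s).card :=
          Finset.card_le_card_of_injOn Fin.val (by intro i; simp) (Fin.val_injective.injOn)
      _ = s := Finset.card_range s
  have hTQ : T ∈ Q := by
    rw [hQ, Finset.mem_powersetCard]
    exact ⟨fun i hi => by simp [hs i hi], hT⟩
  refine lt_of_lt_of_le (Finset.card_lt_card ⟨fun B hB => ?_, fun h' => ?_⟩) hQc
  · simp only [Finset.mem_filter, Finset.mem_powersetCard] at hB
    rw [hQ, Finset.mem_powersetCard]
    refine ⟨fun i hi => ?_, hB.1.2⟩
    by_contra hi'
    simp only [Finset.mem_filter, Finset.mem_univ, true_and, not_lt] at hi'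
    obtain ⟨a, ha, ha'⟩ : ∃ a ∈ T, i ≤ a := by
      by_contra hcon
      push Not at hcon
      exact lt_irrefl _ (Finset.Colex.forall_lt_mono hB.2.le hcon i hi)
    exact absurd (hs a ha) (by have : i.val ≤ a.val := ha'; omega)
  · have := h' hTQ
    simp at this

/-- All `C(s,r)` sets of the first `s` labels precede any `r`-set that has a label outside them. -/
theorem lt_of_mem_smallestSets {s : ℕ} (hsN : s ≤ N) {T : Finset (Fin N)}
    (hT : T ∈ smallestSets N r m) (hm : m ≤ s.choose r) : ∀ i ∈ T, i.val < s := by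
  by_contra hcon
  push Not at hcon
  obtain ⟨i, hi, his⟩ := hcon
  rw [mem_smallestSets] at hT
  have hlt := hT.2.trans_le hm
  set Q := ((Finset.univ : Finset (Fin N)).filter fun i => i.val < s).powersetCard r with hQ
  have hQc : s.choose r ≤ Q.card := by
    rw [hQ, Finset.card_powersetCard]
    apply Nat.choose_le_choose
    rw [Fin.card_filter_val_lt]
    omega
  refine absurd (hQc.trans (Finset.card_le_card fun B hB => ?_)) (not_le.2 hlt)
  rw [hQ, Finset.mem_powersetCard] at hB
  simp only [Finset.mem_filter, Finset.mem_powersetCard, Finset.subset_univ, true_and]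
  refine ⟨hB.2, ?_⟩
  by_contra hle
  have hB' : ∀ b ∈ B, b < i := fun b hb => by
    have := (Finset.mem_filter.1 (hB.1 hb)).2
    exact Fin.lt_def.2 (lt_of_lt_of_le this his)
  exact lt_irrefl _ (Finset.Colex.forall_lt_mono (not_lt.1 hle) hB' i hi)

/-- An injection of a small finite set into `Fin N`. -/
theorem exists_injOn_fin {β : Type*} (W : Finset β) {N : ℕ} (hW : W.card ≤ N) (hN : 0 < N) :
    ∃ g : β → Fin N, Set.InjOn g W := by
  classical
  have : NeZero N := ⟨hN.ne'⟩
  refine ⟨fun b => if h : b ∈ W then Fin.castLE hW (W.equivFin ⟨b, h⟩) else 0, ?_⟩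
  intro a ha b hb h
  have ha : a ∈ W := ha
  have hb : b ∈ W := hb
  simpa [ha, hb] using h

-- Kruskal–Katona is available on `Fin N`, so the families are transported there along an injection.
-- Every set in the iterated shadow is then the image of a member of `𝓛`.
open Finset in
open scoped FinsetFamily in
theorem shadow_transfer {β : Type*} [DecidableEq β] {W : Finset β} {g : β → Fin N}
    (hg : Set.InjOn g W) {𝒬 𝓛 : Finset (Finset β)} {j : ℕ} (hjr : j ≤ r)
    (h𝒬 : ∀ S ∈ 𝒬, S ⊆ W ∧ S.card = r)
    (h𝓛 : ∀ S ∈ 𝒬, ∀ T ⊆ S, T.card = j → T ∈ 𝓛) :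
    ((𝒬.image (Finset.image g) : Finset (Finset (Fin N))) : Set (Finset (Fin N))).Sized r ∧
    (𝒬.image (Finset.image g)).card = 𝒬.card ∧
    (∂^[r - j] (𝒬.image (Finset.image g))).card ≤ 𝓛.card := by
  refine ⟨?_, ?_, ?_⟩
  · intro S' hS'
    obtain ⟨S, hS, rfl⟩ := Finset.mem_image.1 (Finset.mem_coe.1 hS')
    rw [Finset.card_image_of_injOn (hg.mono (by exact_mod_cast (h𝒬 S hS).1)), (h𝒬 S hS).2]
  · apply Finset.card_image_of_injOn
    intro S hS S' hS' h
    have hS := h𝒬 S hS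
    have hS' := h𝒬 S' hS'
    ext a
    constructor
    · intro ha
      obtain ⟨b, hb, hab⟩ := Finset.mem_image.1 (h ▸ Finset.mem_image_of_mem g ha : g a ∈ S'.image g)
      rwa [← hg (hS'.1 hb) (hS.1 ha) hab]
    · intro ha
      obtain ⟨b, hb, hab⟩ := Finset.mem_image.1 (h ▸ Finset.mem_image_of_mem g ha : g a ∈ S.image g)
      rwa [← hg (hS.1 hb) (hS'.1 ha) hab]
  · refine (Finset.card_le_card (t := 𝓛.image (Finset.image g)) fun T hT => ?_).trans
      Finset.card_image_le
    rw [mem_shadow_iterate_iff_exists_mem_card_add] at hT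
    obtain ⟨S', hS', hTS, hc⟩ := hT
    obtain ⟨S, hS, rfl⟩ := Finset.mem_image.1 hS'
    obtain ⟨T', hT', rfl⟩ := Finset.subset_image_iff.1 hTS
    have hT'S : T' ⊆ S := by exact_mod_cast hT'
    have hgS : Set.InjOn g S := hg.mono (by exact_mod_cast (h𝒬 S hS).1)
    rw [Finset.card_image_of_injOn hgS,
      Finset.card_image_of_injOn (hgS.mono (by exact_mod_cast hT'S)), (h𝒬 S hS).2] at hc
    exact Finset.mem_image_of_mem _ (h𝓛 S hS T' hT'S (by omega))

open Finset in
open scoped FinsetFamily in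
/-- A form of the Kruskal–Katona theorem: the `j`-subsets of the first `|𝒬|` sets of size `r` are
among the first `|𝓛|` sets of size `j`, if `𝓛` contains all `j`-subsets of members of `𝒬`. -/
theorem mem_smallestSets_of_subset {β : Type*} [DecidableEq β] {W : Finset β} (hN : 0 < N)
    (hW : W.card ≤ N) {𝒬 𝓛 : Finset (Finset β)} {j : ℕ} (hjr : j ≤ r)
    (h𝒬 : ∀ S ∈ 𝒬, S ⊆ W ∧ S.card = r)
    (h𝓛 : ∀ S ∈ 𝒬, ∀ T ⊆ S, T.card = j → T ∈ 𝓛)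
    {S T : Finset (Fin N)} (hS : S ∈ smallestSets N r 𝒬.card) (hTS : T ⊆ S) (hT : T.card = j) :
    T ∈ smallestSets N j 𝓛.card := by
  obtain ⟨g, hg⟩ := exists_injOn_fin W hW hN
  obtain ⟨h1, h2, h3⟩ := shadow_transfer hg hjr h𝒬 h𝓛
  -- Initial segments minimise the iterated shadow, and their shadows are again initial segments.
  have h4 := iterated_kk (k := r - j) h1 (𝒞 := smallestSets N r 𝒬.card)
    (by rw [h2, card_smallestSets]; exact min_le_left _ _) (smallestSets_isInitSeg _ _ _)
  have h5 : ∀ i, Finset.Colex.IsInitSeg (∂^[i] (smallestSets N r 𝒬.card)) (r - i) := by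
    intro i
    induction i with
    | zero => simpa using smallestSets_isInitSeg _ _ _
    | succ i ih =>
      rw [Function.iterate_succ_apply']
      exact ih.shadow
  have h6 := h5 (r - j)
  rw [Nat.sub_sub_self hjr] at h6
  refine subset_smallestSets_of_isInitSeg h6 (h4.trans h3) ?_
  rw [mem_shadow_iterate_iff_exists_mem_card_add]
  exact ⟨S, hS, hTS, by rw [hT, (mem_smallestSets.1 hS).1]; omega⟩

open Finset in
open scoped FinsetFamily in
theorem choose_le_card_of_shadow {β : Type*} [DecidableEq β] {𝒬 𝓛 : Finset (Finset β)} {j s : ℕ}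
    (hjr : j ≤ r) (hrs : r ≤ s)
    (h𝒬 : ∀ S ∈ 𝒬, S.card = r)
    (h𝓛 : ∀ S ∈ 𝒬, ∀ T ⊆ S, T.card = j → T ∈ 𝓛) (hs : s.choose r ≤ 𝒬.card) :
    s.choose j ≤ 𝓛.card := by
  -- The ground set is enlarged so that it is nonempty and has at least `s` elements, as the Lovász
  -- form requires.
  obtain ⟨g, hg⟩ := exists_injOn_fin (𝒬.biUnion id) (N := (𝒬.biUnion id).card + s + 1)
    (by omega) (by omega)
  obtain ⟨h1, h2, h3⟩ := shadow_transfer hg hjr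
    (fun S hS => ⟨Finset.subset_biUnion_of_mem id hS, h𝒬 S hS⟩) h𝓛
  have := kruskal_katona_lovasz_form (i := r - j) (by omega) hrs (by omega) h1 (by rwa [h2])
  rw [Nat.sub_sub_self hjr] at this
  exact this.trans h3

end

/-! ### The auxiliary graph and claims (1)–(4). -/

namespace UGraph

set_option linter.unusedSectionVars false

variable {α : Type*} [DecidableEq α] {ℓ t : ℕ}

theorem shiftInto_induction {P : Finset (Finset (α ⊕ Fin (t + 1))) → Prop} {x : α}
    (hstep : ∀ F, P F → ∀ c, P (shiftFamily (Sum.inl x) (Sum.inr c) F))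
    (cs : List (Fin (t + 1))) {F : Finset (Finset (α ⊕ Fin (t + 1)))} (hF : P F) :
    P (shiftInto cs F x) := by
  induction cs with
  | nil => exact hF
  | cons c cs ih => exact hstep _ ih c

theorem foldl_shiftInto_induction {P : Finset (Finset (α ⊕ Fin (t + 1))) → Prop}
    (cs : List (Fin (t + 1))) (xs : List α)
    (hstep : ∀ F, P F → ∀ x ∈ xs, ∀ c, P (shiftFamily (Sum.inl x) (Sum.inr c) F))
    {F : Finset (Finset (α ⊕ Fin (t + 1)))} (hF : P F) :
    P (xs.foldl (shiftInto cs) F) := by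
  induction xs generalizing F with
  | nil => exact hF
  | cons x xs ih =>
    exact ih (fun F hF y hy => hstep F hF y (List.mem_cons_of_mem _ hy))
      (shiftInto_induction (fun F hF c => hstep F hF x List.mem_cons_self c) cs hF)

theorem closedUnder_shiftInto (cs : List (Fin (t + 1))) (F : Finset (Finset (α ⊕ Fin (t + 1))))
    (x : α) {c : Fin (t + 1)} (hc : c ∈ cs) :
    ClosedUnder (Sum.inl x) (Sum.inr c) (shiftInto cs F x) := by
  induction cs with
  | nil => simp at hc
  | cons c' cs ih =>
    change ClosedUnder _ _ (shiftFamily (Sum.inl x) (Sum.inr c') (shiftInto cs F x))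
    by_cases h : c = c'
    · rw [h]
      exact closedUnder_shiftFamily (by simp) _
    · exact (ih ((List.mem_cons.1 hc).resolve_left h)).shiftFamily (by simp) (by simp) (by simp)
        (by simp)

theorem closedUnder_foldl_shiftInto (cs : List (Fin (t + 1))) (xs : List α)
    (F : Finset (Finset (α ⊕ Fin (t + 1)))) {x : α} (hx : x ∈ xs) {c : Fin (t + 1)} (hc : c ∈ cs) :
    ClosedUnder (Sum.inl x) (Sum.inr c) (xs.foldl (shiftInto cs) F) := by
  induction xs generalizing F with
  | nil => simp at hx
  | cons y xs ih =>
    rcases List.mem_cons.1 hx with rfl | h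
    · exact foldl_shiftInto_induction (P := ClosedUnder (Sum.inl x) (Sum.inr c)) cs xs
        (fun F hF y _ c' => hF.shiftFamily (by simp) (by simp) (by simp) (by simp))
        (closedUnder_shiftInto cs F x hc)
    · exact ih _ h

variable {G : UGraph α ℓ} {A₁ A₂ : Finset α} {v : Fin (t + 1) ↪ α} {xs : List α}
  {cs : List (Fin (t + 1))}

theorem label_castAdd (v : Fin (t + 1) ↪ α) (i : Fin (t + 1)) :
    label v (Fin.castAdd (t + 1) i) = Sum.inl (v i) := by
  simp [label]

theorem label_natAdd (v : Fin (t + 1) ↪ α) (i : Fin (t + 1)) :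
    label v (Fin.natAdd (t + 1) i) = Sum.inr i := by
  change Sum.map v id (finSumFinEquiv.symm (Fin.natAdd (t + 1) i)) = _
  rw [finSumFinEquiv_symm_apply_natAdd]
  rfl

theorem mem_of_label_eq_inl (hv : Finset.univ.map v = A₁) {i : Fin ((t + 1) + (t + 1))} {a : α}
    (h : label v i = Sum.inl a) : a ∈ A₁ := by
  induction i using Fin.addCases with
  | left i =>
    rw [label_castAdd] at h
    rw [← Sum.inl_injective h, ← hv]
    simp
  | right i =>
    rw [label_natAdd] at h
    simp at h

theorem mem_auxEdges {E : Finset (α ⊕ Fin (t + 1))} :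
    E ∈ G.auxEdges A₁ A₂ v ↔
      (∃ e ∈ G.edges, (e ⊆ A₁ ∨ e ⊆ A₂ ∨ Disjoint e (A₁ ∪ A₂)) ∧
        e.map Function.Embedding.inl = E) ∨
      ∃ Y ⊆ G.boundary A₁ A₂, 0 < Y.card ∧ Y.card ≤ ℓ - 1 ∧
        ∃ S ∈ smallestSets ((t + 1) + (t + 1)) (ℓ - Y.card) (G.link Y (A₁ ∪ A₂)).card,
          Y.map Function.Embedding.inl ∪ S.map (label v) = E := by
  simp only [auxEdges, Finset.mem_union, Finset.mem_image, Finset.mem_filter, Finset.mem_biUnion,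
    Finset.mem_powerset, and_assoc]

/-- A shift out of `c` moves only sets containing `c`, so edges inside `V` survive all of them. -/
theorem map_inl_mem_shiftedEdges {e : Finset α} (h : e.map Function.Embedding.inl ∈
    G.auxEdges A₁ A₂ v) : e.map Function.Embedding.inl ∈ G.shiftedEdges A₁ A₂ v xs cs :=
  foldl_shiftInto_induction (P := fun F => e.map Function.Embedding.inl ∈ F) cs xs
    (fun F hF x _ c => mem_shiftFamily_of_notMem (by simp) hF (by simp)) h

theorem mem_link {Y S T : Finset α} :
    T ∈ G.link Y S ↔ T ⊆ S ∧ T.card = ℓ - Y.card ∧ T ∪ Y ∈ G.edges := by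
  simp [link, and_assoc]

theorem mem_boundary {u : α} : u ∈ G.boundary A₁ A₂ ↔ u ∈ G.verts ∧ u ∉ A₁ ∪ A₂ ∧
    ∃ w ∈ A₁ ∪ A₂, G.IsNeighbor u w := by
  simp only [boundary, Finset.mem_filter, Finset.mem_sdiff, and_assoc]

theorem mem_boundary_of_edge {T Y : Finset α} (hT : T ⊆ A₁ ∪ A₂) (hT0 : T.Nonempty)
    (hY : Disjoint Y (A₁ ∪ A₂)) (he : T ∪ Y ∈ G.edges) : Y ⊆ G.boundary A₁ A₂ := by
  intro y hy
  obtain ⟨w, hw⟩ := hT0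
  have hyA := Finset.disjoint_left.1 hY hy
  refine mem_boundary.2 ⟨G.subset_verts _ he (Finset.mem_union_right _ hy), hyA, w, hT hw, ?_, ?_⟩
  · rintro rfl; exact hyA (hT hw)
  · exact ⟨_, he, Finset.mem_union_right _ hy, Finset.mem_union_left _ hw⟩

/-- The size of every edge of the auxiliary graph. -/
theorem card_of_mem_auxEdges (hv : Finset.univ.map v = A₁) {E : Finset (α ⊕ Fin (t + 1))}
    (hE : E ∈ G.auxEdges A₁ A₂ v) : E.card = ℓ := by
  rcases mem_auxEdges.1 hE with ⟨e, he, _, rfl⟩ | ⟨Y, hY, hY0, hYl, S, hS, rfl⟩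
  · rw [Finset.card_map, G.card_eq e he]
  · rw [Finset.card_union_of_disjoint, Finset.card_map, Finset.card_map,
      (mem_smallestSets.1 hS).1]
    · omega
    · rw [Finset.disjoint_left]
      intro a ha ha'
      obtain ⟨y, hy, rfl⟩ := Finset.mem_map.1 ha
      obtain ⟨i, _, hi⟩ := Finset.mem_map.1 ha'
      exact (mem_boundary.1 (hY hy)).2.1 (Finset.mem_union_left _ (mem_of_label_eq_inl hv hi))

theorem card_auxEdges_le : (G.auxEdges A₁ A₂ v).card ≤ G.edges.card := by
  classical
  set p : Finset α → Prop := fun e => e ⊆ A₁ ∨ e ⊆ A₂ ∨ Disjoint e (A₁ ∪ A₂) with hp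
  set 𝒴 := (G.boundary A₁ A₂).powerset.filter fun Y => 0 < Y.card ∧ Y.card ≤ ℓ - 1 with h𝒴
  have h1 : (G.auxEdges A₁ A₂ v).card ≤ (G.edges.filter p).card +
      ∑ Y ∈ 𝒴, (G.link Y (A₁ ∪ A₂)).card := by
    unfold auxEdges
    refine (Finset.card_union_le _ _).trans (add_le_add ?_ ?_)
    · convert Finset.card_image_le
    · refine Finset.card_biUnion_le.trans ?_
      simp only [h𝒴]
      refine le_trans (Finset.sum_le_sum fun Y hY => ?_) (le_of_eq (by congr))
      refine Finset.card_image_le.trans ?_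
      rw [card_smallestSets]
      exact min_le_left _ _
  have h2 : ∑ Y ∈ 𝒴, (G.link Y (A₁ ∪ A₂)).card ≤ (G.edges.filter fun e => ¬ p e).card := by
    -- The edges of `G` that are not kept are sorted by their trace outside `A₁ ∪ A₂`; the link of
    -- `Y` injects into the class of `Y` by `T ↦ T ∪ Y`.
    have h3 := Finset.sum_card_fiberwise_eq_card_filter (G.edges.filter fun e => ¬ p e) 𝒴
      (fun e => e \ (A₁ ∪ A₂))
    refine le_trans ?_ (h3.le.trans (Finset.card_le_card (Finset.filter_subset _ _)))
    refine Finset.sum_le_sum fun Y hY => ?_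
    simp only [h𝒴, Finset.mem_filter, Finset.mem_powerset] at hY
    have hYA : Disjoint Y (A₁ ∪ A₂) :=
      Finset.disjoint_left.2 fun y hy => (mem_boundary.1 (hY.1 hy)).2.1
    have hsd : ∀ T ⊆ A₁ ∪ A₂, (T ∪ Y) \ (A₁ ∪ A₂) = Y := fun T hT => by
      rw [Finset.union_sdiff_distrib, Finset.sdiff_eq_empty_iff_subset.2 hT,
        Finset.empty_union, Finset.sdiff_eq_self_of_disjoint hYA]
    refine Finset.card_le_card_of_injOn (fun T => T ∪ Y) ?_ ?_
    · intro T hT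
      obtain ⟨hTA, hTc, hTe⟩ := mem_link.1 hT
      simp only [Finset.coe_filter, Set.mem_ofPred_eq, Finset.mem_filter]
      refine ⟨⟨hTe, ?_⟩, hsd T hTA⟩
      obtain ⟨y, hy⟩ := Finset.card_pos.1 hY.2.1
      obtain ⟨w, hw⟩ := Finset.card_pos.1 (show 0 < T.card by omega)
      have hyA := Finset.disjoint_left.1 hYA hy
      rintro (h | h | h)
      · exact hyA (Finset.mem_union_left _ (h (Finset.mem_union_right _ hy)))
      · exact hyA (Finset.mem_union_right _ (h (Finset.mem_union_right _ hy)))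
      · exact Finset.disjoint_left.1 h (Finset.mem_union_left _ hw) (hTA hw)
    · intro T hT T' hT' h
      have hT := (mem_link.1 hT).1
      have hT' := (mem_link.1 hT').1
      have key : ∀ S ⊆ A₁ ∪ A₂, (S ∪ Y) ∩ (A₁ ∪ A₂) = S := fun S hS => by
        rw [Finset.union_inter_distrib_right, Finset.disjoint_iff_inter_eq_empty.1 hYA,
          Finset.union_empty, Finset.inter_eq_left.2 hS]
      have h : T ∪ Y = T' ∪ Y := h
      rw [← key T hT, ← key T' hT', h]
  have h4 := Finset.card_filter_add_card_filter_not (s := G.edges) p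
  omega

theorem card_shiftedEdges : (G.shiftedEdges A₁ A₂ v xs cs).card = (G.auxEdges A₁ A₂ v).card :=
  foldl_shiftInto_induction (P := fun F => F.card = (G.auxEdges A₁ A₂ v).card) cs xs
    (fun F hF x _ c => by rw [card_shiftFamily F (by simp), hF]) rfl

theorem mem_transform_edges {e : Finset α} : e ∈ (G.transform A₁ A₂ v xs cs).edges ↔
    (e ⊆ G.verts ∧ e.card = ℓ) ∧ e.map Function.Embedding.inl ∈ G.shiftedEdges A₁ A₂ v xs cs := by
  simp [transform]

theorem card_transform_edges_le : (G.transform A₁ A₂ v xs cs).edges.card ≤ G.edges.card := by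
  refine le_trans ?_ ((card_shiftedEdges (xs := xs) (cs := cs)).le.trans
    (card_auxEdges_le (G := G) (A₁ := A₁) (A₂ := A₂) (v := v)))
  refine Finset.card_le_card_of_injOn (fun e => e.map Function.Embedding.inl) ?_
    ((Finset.map_injective _).injOn)
  intro e he
  exact (mem_transform_edges.1 he).2

theorem map_inl_mem_auxEdges {e : Finset α} (he : e ∈ G.edges)
    (h : e ⊆ A₁ ∨ e ⊆ A₂ ∨ Disjoint e (A₁ ∪ A₂)) :
    e.map Function.Embedding.inl ∈ G.auxEdges A₁ A₂ v :=
  mem_auxEdges.2 (Or.inl ⟨e, he, h, rfl⟩)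

theorem InducesK.mem_edges {s : ℕ} {S : Finset α} (h : G.InducesK s S) {e : Finset α} (he : e ⊆ S)
    (hc : e.card = ℓ) : e ∈ G.edges :=
  h.2.2 (Finset.mem_powersetCard.2 ⟨he, hc⟩)

theorem inducesK_transform {s : ℕ} {S : Finset α} (hS : S ⊆ G.verts) (hs : S.card = s)
    (h : ∀ e ⊆ S, e.card = ℓ → e.map Function.Embedding.inl ∈ G.auxEdges A₁ A₂ v) :
    (G.transform A₁ A₂ v xs cs).InducesK s S := by
  refine ⟨hS, hs, fun e he => ?_⟩
  obtain ⟨he, hc⟩ := Finset.mem_powersetCard.1 he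
  exact mem_transform_edges.2 ⟨⟨he.trans hS, hc⟩, map_inl_mem_shiftedEdges (h e he hc)⟩

/-- The property is proved for all edges on `V ∪ C` and is invariant under the shifts. If a shifted
edge contains `a ∈ A₂ \ A₁`, then so did its preimage, since `a` is never a target. But that
preimage contained a vertex of `C`, so it was not inside `A₂`. -/
theorem subset_of_mem_transform_edges (hv : Finset.univ.map v = A₁)
    (hxs : ∀ x ∈ xs, x ∉ A₂ \ A₁) {e : Finset α} (he : e ∈ (G.transform A₁ A₂ v xs cs).edges)
    (hne : (e ∩ (A₂ \ A₁)).Nonempty) : e ⊆ A₂ := by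
  have key : ∀ E ∈ G.shiftedEdges A₁ A₂ v xs cs, (∃ a ∈ A₂ \ A₁, Sum.inl a ∈ E) →
      ∃ f ⊆ A₂, f.map Function.Embedding.inl = E := by
    refine foldl_shiftInto_induction (P := fun F => ∀ E ∈ F, (∃ a ∈ A₂ \ A₁, Sum.inl a ∈ E) →
      ∃ f ⊆ A₂, f.map Function.Embedding.inl = E) cs xs ?_ ?_
    · intro F hF x hx c E hE ⟨a, ha, haE⟩
      rcases (mem_shiftFamily (by simp)).1 hE with ⟨h, _⟩ | ⟨_, _, h⟩
      · exact hF E h ⟨a, ha, haE⟩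
      · obtain ⟨f, _, hf⟩ := hF _ h ⟨a, ha, by
          simp only [Finset.mem_sdiff, Finset.mem_union, Finset.mem_singleton, haE, true_or,
            true_and, Sum.inl.injEq]
          rintro rfl
          exact hxs _ hx ha⟩
        have : (Sum.inr c : α ⊕ Fin (t + 1)) ∈ f.map Function.Embedding.inl := by
          rw [hf]; simp
        simp at this
    · rintro E hE ⟨a, ha, haE⟩
      obtain ⟨haA₂, haA₁⟩ := Finset.mem_sdiff.1 ha
      rcases mem_auxEdges.1 hE with ⟨f, hf, h, rfl⟩ | ⟨Y, hY, _, _, S, _, rfl⟩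
      · have haf : a ∈ f := by simpa using haE
        refine ⟨f, ?_, rfl⟩
        rcases h with h | h | h
        · exact absurd (h haf) haA₁
        · exact h
        · exact absurd (Finset.mem_union_right _ haA₂) (Finset.disjoint_left.1 h haf)
      · exfalso
        rcases Finset.mem_union.1 haE with h | h
        · have : a ∈ Y := by simpa using h
          exact (mem_boundary.1 (hY this)).2.1 (Finset.mem_union_right _ haA₂)
        · obtain ⟨i, _, hi⟩ := Finset.mem_map.1 h
          exact haA₁ (mem_of_label_eq_inl hv hi)
  obtain ⟨a, ha⟩ := hne
  obtain ⟨hae, ha⟩ := Finset.mem_inter.1 ha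
  obtain ⟨f, hf, hfe⟩ := key _ (mem_transform_edges.1 he).2 ⟨a, ha, by simpa using hae⟩
  rwa [← Finset.map_injective _ hfe]

theorem mem_firstVertices {m : ℕ} {a : α} :
    a ∈ firstVertices v m ↔ ∃ i : Fin (t + 1), i.val < m ∧ v i = a := by
  simp [firstVertices]

theorem firstVertices_subset (hv : Finset.univ.map v = A₁) (m : ℕ) : firstVertices v m ⊆ A₁ := by
  intro a ha
  obtain ⟨i, _, rfl⟩ := mem_firstVertices.1 ha
  rw [← hv]
  simp

theorem card_firstVertices {m : ℕ} (hm : m ≤ t + 1) : (firstVertices v m).card = m := by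
  rw [firstVertices, Finset.card_map, Fin.card_filter_val_lt]
  omega

/-- `Y` together with a set of first vertices is an edge of the auxiliary graph, if the link of
`Y` is large. -/
theorem map_inl_union_mem_auxEdges {Y S : Finset α} {m : ℕ} (hY : Y ⊆ G.boundary A₁ A₂)
    (hY0 : 0 < Y.card) (hYl : Y.card ≤ ℓ - 1) (hS : S ⊆ firstVertices v m)
    (hSc : S.card = ℓ - Y.card) (hm : m.choose (ℓ - Y.card) ≤ (G.link Y (A₁ ∪ A₂)).card) :
    (Y ∪ S).map Function.Embedding.inl ∈ G.auxEdges A₁ A₂ v := by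
  obtain ⟨T, hT, rfl⟩ := Finset.subset_map_iff.1 hS
  refine mem_auxEdges.2 (Or.inr ⟨Y, hY, hY0, hYl, T.map (Fin.castAddEmb (t + 1)), ?_, ?_⟩)
  · refine mem_smallestSets_of_lt (s := m) (by simpa using hSc) ?_ hm
    intro i hi
    obtain ⟨j, hj, rfl⟩ := Finset.mem_map.1 hi
    simpa using hT hj
  · rw [Finset.map_union, Finset.map_map, Finset.map_map]
    congr 2
    ext i : 1
    simp [label_castAdd]

/-- For a mixed edge with trace `Y` outside `A`, the link of `Y` contains all subsets of `A₃ ∩ A` of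
the right size. It thus has at least `C(m, ℓ-|Y|)` members, so compression fills all such subsets of
the first `m` labels. -/
theorem InducesK.transform_union_firstVertices (hA₁ : G.InducesK (t + 1) A₁)
    (hv : Finset.univ.map v = A₁) {A₃ : Finset α} (hA₃ : G.InducesK (t + 1) A₃) :
    (G.transform A₁ A₂ v xs cs).InducesK (t + 1)
      ((A₃ \ (A₁ ∪ A₂)) ∪ firstVertices v (A₃ ∩ (A₁ ∪ A₂)).card) := by
  set A := A₁ ∪ A₂ with hA
  set m := (A₃ ∩ A).card with hm
  have hmt : m ≤ t + 1 := (Finset.card_le_card Finset.inter_subset_left).trans hA₃.2.1.le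
  have hfA₁ := firstVertices_subset (m := m) hv
  have hdisj : Disjoint (A₃ \ A) (firstVertices v m) :=
    Finset.sdiff_disjoint.mono_right (hfA₁.trans Finset.subset_union_left)
  apply inducesK_transform
  · exact Finset.union_subset (Finset.sdiff_subset.trans hA₃.1) (hfA₁.trans hA₁.1)
  · rw [Finset.card_union_of_disjoint hdisj, card_firstVertices hmt, hm,
      Finset.card_sdiff_add_card_inter, hA₃.2.1]
  · intro e he hec
    set Y := e \ A with hYdef
    set S := e ∩ A with hSdef
    have hYS : Y ∪ S = e := Finset.sdiff_union_inter e A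
    have hcard : Y.card + S.card = ℓ := by rw [Finset.card_sdiff_add_card_inter, hec]
    have hSf : S ⊆ firstVertices v m := by
      intro a ha
      obtain ⟨hae, haA⟩ := Finset.mem_inter.1 ha
      rcases Finset.mem_union.1 (he hae) with h | h
      · exact absurd haA (Finset.mem_sdiff.1 h).2
      · exact h
    have hYA₃ : Y ⊆ A₃ := by
      intro a ha
      obtain ⟨hae, haA⟩ := Finset.mem_sdiff.1 ha
      rcases Finset.mem_union.1 (he hae) with h | h
      · exact (Finset.mem_sdiff.1 h).1
      · exact absurd (Finset.mem_union_left _ (hfA₁ h)) haA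
    have hYA : Disjoint Y A := Finset.sdiff_disjoint
    rcases Y.eq_empty_or_nonempty with hY0 | hY0
    · have heA₁ : e ⊆ A₁ := by
        rw [← hYS, hY0, Finset.empty_union]
        exact hSf.trans hfA₁
      exact map_inl_mem_auxEdges (hA₁.mem_edges heA₁ hec) (Or.inl heA₁)
    rcases S.eq_empty_or_nonempty with hS0 | hS0
    · have heY : e = Y := by rw [← hYS, hS0, Finset.union_empty]
      exact map_inl_mem_auxEdges (hA₃.mem_edges (heY ▸ hYA₃) hec) (Or.inr (Or.inr (heY ▸ hYA)))
    have hY1 := Finset.card_pos.2 hY0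
    have hS1 := Finset.card_pos.2 hS0
    have hlink : (A₃ ∩ A).powersetCard (ℓ - Y.card) ⊆ G.link Y A := by
      intro T hT
      obtain ⟨hTs, hTc⟩ := Finset.mem_powersetCard.1 hT
      have hTA := hTs.trans Finset.inter_subset_right
      refine mem_link.2 ⟨hTA, hTc, hA₃.mem_edges
        (Finset.union_subset (hTs.trans Finset.inter_subset_left) hYA₃) ?_⟩
      rw [Finset.card_union_of_disjoint (hYA.symm.mono_left hTA), hTc]
      omega
    have hle : m.choose (ℓ - Y.card) ≤ (G.link Y A).card := by
      rw [hm, ← Finset.card_powersetCard]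
      exact Finset.card_le_card hlink
    rw [← hYS]
    refine map_inl_union_mem_auxEdges ?_ hY1 (by omega) hSf (by omega) hle
    have hSm : S.card ≤ m := (Finset.card_le_card hSf).trans (card_firstVertices hmt).le
    obtain ⟨T, hT⟩ := Finset.powersetCard_nonempty.2 (show ℓ - Y.card ≤ (A₃ ∩ A).card by omega)
    obtain ⟨h1, h2, h3⟩ := mem_link.1 (hlink hT)
    exact mem_boundary_of_edge h1 (Finset.card_pos.1 (by omega)) hYA h3

end UGraph

/-! ### An upper bound for the number of edges of an extremal graph. -/

theorem choose_add_le (a b r : ℕ) :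
    (a + r).choose (b + 1) ≤ a.choose (b + 1) + r * (a + r - 1).choose b := by
  induction r with
  | zero => simp
  | succ r ih =>
    have h1 : (a + (r + 1)).choose (b + 1) = (a + r).choose b + (a + r).choose (b + 1) :=
      Nat.choose_succ_succ _ _
    have h2 : (a + r - 1).choose b ≤ (a + r).choose b := Nat.choose_le_choose b (Nat.sub_le _ _)
    have h3 : a + (r + 1) - 1 = a + r := by omega
    rw [h1, h3]
    nlinarith [Nat.mul_le_mul_left r h2]

namespace UGraph

set_option linter.unusedSectionVars false

variable {α : Type*} [DecidableEq α] {ℓ : ℕ}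

theorem InducesK.choose_le_numCopies {G : UGraph α ℓ} {t k : ℕ} (hk : 1 ≤ k) {W : Finset α}
    (hW : G.InducesK (t + 1) W) {u : α} (hu : u ∈ W) : t.choose (k - 1) ≤ G.numCopies k u := by
  classical
  have h1 : ((W.erase u).powersetCard (k - 1)).card = t.choose (k - 1) := by
    rw [Finset.card_powersetCard, Finset.card_erase_of_mem hu, hW.2.1, Nat.add_sub_cancel]
  rw [← h1, numCopies]
  refine Finset.card_le_card_of_injOn (fun T => insert u T) ?_ ?_
  · intro T hT
    obtain ⟨hT, hTc⟩ := Finset.mem_powersetCard.1 (Finset.mem_coe.1 hT)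
    have huT : u ∉ T := fun h => by simpa using hT h
    have hins : insert u T ⊆ W := Finset.insert_subset hu (hT.trans (Finset.erase_subset _ _))
    simp only [Finset.coe_filter, Set.mem_ofPred_eq, Finset.mem_powerset]
    refine ⟨hins.trans hW.1, Finset.mem_insert_self _ _, hins.trans hW.1, ?_,
      (Finset.powersetCard_mono hins).trans hW.2.2⟩
    rw [Finset.card_insert_of_notMem huT, hTc]
    omega
  · intro T hT T' hT' h
    have hT := (Finset.mem_powersetCard.1 (Finset.mem_coe.1 hT)).1
    have hT' := (Finset.mem_powersetCard.1 (Finset.mem_coe.1 hT')).1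
    have h1 : u ∉ T := fun h => by simpa using hT h
    have h2 : u ∉ T' := fun h => by simpa using hT' h
    have h : insert u T = insert u T' := h
    rw [← Finset.erase_insert h1, h, Finset.erase_insert h2]

/-- The `ℓ`-graph on `U` whose edges are the `ℓ`-subsets of the blocks `W i ⊆ U`, `i < p`. -/
def ofBlocks (ℓ : ℕ) (U : Finset α) (p : ℕ) (W : ℕ → Finset α) : UGraph α ℓ where
  verts := U
  edges := (Finset.range p).biUnion fun i => (W i ∩ U).powersetCard ℓ
  subset_verts := by
    intro e he
    obtain ⟨i, _, hi⟩ := Finset.mem_biUnion.1 he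
    exact (Finset.mem_powersetCard.1 hi).1.trans Finset.inter_subset_right
  card_eq := by
    intro e he
    obtain ⟨i, _, hi⟩ := Finset.mem_biUnion.1 he
    exact (Finset.mem_powersetCard.1 hi).2

theorem inducesK_ofBlocks {U : Finset α} {p i s : ℕ} {W : ℕ → Finset α} (hi : i < p)
    (hW : W i ⊆ U) (hs : (W i).card = s) : (ofBlocks ℓ U p W).InducesK s (W i) := by
  refine ⟨hW, hs, fun e he => Finset.mem_biUnion.2 ⟨i, Finset.mem_range.2 hi, ?_⟩⟩
  rwa [Finset.inter_eq_left.2 hW]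

/-- A graph made of disjoint cliques on `t + 1` vertices, except that the last two overlap. -/
theorem exists_cliqueCondition_graph (U : Finset α) {k t q r : ℕ} (hk : 1 ≤ k) (hr : r ≤ t)
    (hq : 1 ≤ q) (hU : U.card = q * (t + 1) + r) :
    ∃ H : UGraph α ℓ, H.verts = U ∧ H.CliqueCondition k t ∧
      H.edges.card + (t + 1 - r).choose ℓ ≤ (q + 1) * (t + 1).choose ℓ := by
  classical
  set n := q * (t + 1) + r with hn
  have hqt : (q - 1) * (t + 1) + (t + 1) = q * (t + 1) := by
    obtain ⟨q', rfl⟩ : ∃ q', q = q' + 1 := ⟨q - 1, by omega⟩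
    rw [Nat.add_sub_cancel]; ring
  have hn0 : 0 < n := by omega
  have hU0 : U.Nonempty := Finset.card_pos.1 (by omega)
  obtain ⟨u₀, hu₀⟩ := hU0
  let e : Fin n ≃ U := (U.equivFinOfCardEq hU).symm
  let φ : ℕ → α := fun i => if h : i < n then (e ⟨i, h⟩ : α) else u₀
  have hφU : ∀ i, φ i ∈ U := by
    intro i
    by_cases h : i < n
    · simp [φ, h]
    · simpa [φ, h] using hu₀
  have hφ : Set.InjOn φ (Finset.range n) := by
    intro i hi j hj hij
    have hi : i < n := by simpa using hi
    have hj : j < n := by simpa using hj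
    simpa [φ, hi, hj, Subtype.coe_inj] using hij
  have hφs : ∀ u ∈ U, ∃ i < n, φ i = u := by
    intro u hu
    refine ⟨e.symm ⟨u, hu⟩, (e.symm ⟨u, hu⟩).2, ?_⟩
    simp [φ]
  have hcard : ∀ a b, b ≤ n → ((Finset.Ico a b).image φ).card = b - a := by
    intro a b hb
    rw [Finset.card_image_of_injOn (hφ.mono ?_), Nat.card_Ico]
    intro i hi
    simp only [Finset.coe_Ico, Set.mem_Ico, Finset.coe_range, Set.mem_Iio] at hi ⊢
    omega
  have hsub : ∀ a b, (Finset.Ico a b).image φ ⊆ U := by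
    intro a b u hu
    obtain ⟨i, _, rfl⟩ := Finset.mem_image.1 hu
    exact hφU i
  -- Starting points of the blocks: `q` consecutive disjoint ones, and a final one consisting of the
  -- last `t + 1` vertices.
  let a : ℕ → ℕ := fun i => if i < q then i * (t + 1) else n - (t + 1)
  have ha : ∀ i, a i + (t + 1) ≤ n := by
    intro i
    by_cases h : i < q
    · have : (i + 1) * (t + 1) ≤ q * (t + 1) := Nat.mul_le_mul_right _ h
      simp only [a, h, if_true]
      nlinarith
    · simp only [a, h, if_false]
      omega
  let W : ℕ → Finset α := fun i => (Finset.Ico (a i) (a i + (t + 1))).image φ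
  have hWc : ∀ i, (W i).card = t + 1 := by
    intro i
    simp only [W]
    rw [hcard _ _ (ha i)]
    omega
  have hWU : ∀ i, W i ⊆ U := fun i => hsub _ _
  refine ⟨ofBlocks ℓ U (q + 1) W, rfl, ?_, ?_⟩
  · intro u hu
    obtain ⟨i, hi, rfl⟩ := hφs u hu
    have : ∃ j < q + 1, φ i ∈ W j := by
      by_cases h : i < q * (t + 1)
      · have h1 : i / (t + 1) < q := Nat.div_lt_of_lt_mul (by rwa [mul_comm])
        refine ⟨i / (t + 1), by omega, Finset.mem_image_of_mem φ ?_⟩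
        simp only [a, h1, if_true, Finset.mem_Ico]
        have h2 := Nat.div_add_mod i (t + 1)
        have h3 := Nat.mod_lt i (Nat.succ_pos t)
        rw [mul_comm] at h2
        simp only [Nat.succ_eq_add_one] at h3
        omega
      · refine ⟨q, by omega, Finset.mem_image_of_mem φ ?_⟩
        simp only [a, lt_irrefl, if_false, Finset.mem_Ico]
        omega
    obtain ⟨j, hj, hij⟩ := this
    exact (inducesK_ofBlocks hj (hWU j) (hWc j)).choose_le_numCopies hk hij
  -- `I` is the overlap of the last two blocks; its `ℓ`-subsets would otherwise be counted twice.
  · set I := (Finset.Ico ((q - 1) * (t + 1) + r) (q * (t + 1))).image φ with hI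
    have hIc : I.card = t + 1 - r := by
      rw [hI, hcard _ _ (by omega)]
      omega
    have hIq : I ⊆ W q := by
      apply Finset.image_subset_image
      intro i
      simp only [a, lt_irrefl, if_false, Finset.mem_Ico]
      omega
    have hIq' : I ⊆ W (q - 1) := by
      apply Finset.image_subset_image
      intro i
      simp only [a, show q - 1 < q by omega, if_true, Finset.mem_Ico]
      omega
    have hedges : (ofBlocks ℓ U (q + 1) W).edges ⊆
        ((Finset.range q).biUnion fun i => (W i).powersetCard ℓ) ∪
          ((W q).powersetCard ℓ \ I.powersetCard ℓ) := by
      intro f hf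
      obtain ⟨i, hi, hfi⟩ := Finset.mem_biUnion.1 hf
      rw [Finset.inter_eq_left.2 (hWU i)] at hfi
      rw [Finset.mem_union, Finset.mem_biUnion]
      by_cases hiq : i < q
      · exact Or.inl ⟨i, Finset.mem_range.2 hiq, hfi⟩
      · have : i = q := by have := Finset.mem_range.1 hi; omega
        subst this
        by_cases hfI : f ∈ I.powersetCard ℓ
        · exact Or.inl ⟨i - 1, Finset.mem_range.2 (by omega), Finset.powersetCard_mono hIq' hfI⟩
        · exact Or.inr (Finset.mem_sdiff.2 ⟨hfi, hfI⟩)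
    have h1 := (Finset.card_le_card hedges).trans (Finset.card_union_le _ _)
    have h2 : ((Finset.range q).biUnion fun i => (W i).powersetCard ℓ).card ≤
        q * (t + 1).choose ℓ := by
      refine Finset.card_biUnion_le.trans ?_
      simp [Finset.card_powersetCard, hWc]
    have h3 : ((W q).powersetCard ℓ \ I.powersetCard ℓ).card =
        (t + 1).choose ℓ - (t + 1 - r).choose ℓ := by
      rw [Finset.card_sdiff_of_subset (Finset.powersetCard_mono hIq), Finset.card_powersetCard,
        Finset.card_powersetCard, hWc, hIc]
    have h4 : (t + 1 - r).choose ℓ ≤ (t + 1).choose ℓ := Nat.choose_le_choose _ (Nat.sub_le _ _)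
    have h5 : (q + 1) * (t + 1).choose ℓ = q * (t + 1).choose ℓ + (t + 1).choose ℓ := by ring
    omega

/-- Extremality is used by comparison with the clique construction. With `n = q(t+1) + r` and `s = t
- r`, its excess over `n C(t, ℓ-1)` is at most `(s+1)(C(t, ℓ-1) - C(s, ℓ-1)) ≤ (s+1) r C(t-1, ℓ-2)`.
-/
theorem IsExtremal.edges_le {G : UGraph α ℓ} {k t n : ℕ} (hG : G.IsExtremal k t n) (hℓ : 2 ≤ ℓ)
    (hk : 1 ≤ k) (hn : t + 1 ≤ n) :
    4 * (ℓ * G.edges.card) ≤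
      4 * (n * t.choose (ℓ - 1)) + (t + 1) ^ 2 * (t - 1).choose (ℓ - 2) := by
  obtain ⟨b, rfl⟩ : ∃ b, ℓ = b + 2 := ⟨ℓ - 2, by omega⟩
  have hr : n % (t + 1) ≤ t := Nat.lt_succ_iff.1 (Nat.mod_lt _ (Nat.succ_pos _))
  have hq : 1 ≤ n / (t + 1) := (Nat.one_le_div_iff (Nat.succ_pos _)).2 hn
  have hqr : n = n / (t + 1) * (t + 1) + n % (t + 1) := by
    rw [mul_comm]; exact (Nat.div_add_mod n (t + 1)).symm
  generalize n % (t + 1) = r at *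
  generalize n / (t + 1) = q at *
  obtain ⟨H, hHU, hHk, hHe⟩ := exists_cliqueCondition_graph (ℓ := b + 2) G.verts hk hr hq
    (hG.1.trans hqr)
  have hle := hG.2.2 H (by rw [hHU, hG.1]) hHk
  obtain ⟨s, rfl⟩ : ∃ s, t = s + r := ⟨t - r, by omega⟩
  have h1 : s + r + 1 - r = s + 1 := by omega
  rw [h1] at hHe
  have h2 := Nat.add_one_mul_choose_eq (s + r) (b + 1)
  have h3 := Nat.add_one_mul_choose_eq s (b + 1)
  have h4 := choose_add_le s b r
  simp only [show b + 1 + 1 = b + 2 from rfl, Nat.add_sub_cancel,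
    show b + 2 - 1 = b + 1 from rfl] at *
  generalize (s + r + 1).choose (b + 2) = X at *
  generalize (s + 1).choose (b + 2) = Z at *
  generalize (s + r).choose (b + 1) = d at *
  generalize s.choose (b + 1) = d' at *
  generalize (s + r - 1).choose b = C at *
  generalize G.edges.card = E at *
  generalize H.edges.card = E' at *
  have h5 : (b + 2) * E + (b + 2) * Z ≤ (q + 1) * (X * (b + 2)) := by nlinarith
  rw [← h2] at h5
  have h6 : (b + 2) * Z = (s + 1) * d' := by rw [h3]; ring
  rw [h6] at h5
  have h7 : (s + 1) * d ≤ (s + 1) * d' + (s + 1) * (r * C) := by nlinarith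
  have h8 : (q + 1) * ((s + r + 1) * d) = n * d + (s + 1) * d := by rw [hqr]; ring
  have h9 : (b + 2) * E ≤ n * d + (s + 1) * r * C := by nlinarith
  -- AM–GM with `(s+1) + r = t + 1`; this is the origin of the constant `1/4`.
  have h10 : 4 * ((s + 1) * r) ≤ (s + r + 1) ^ 2 := by
    zify; nlinarith [sq_nonneg ((s : ℤ) + 1 - r)]
  nlinarith [Nat.mul_le_mul_right C h10]

end UGraph

/-! ### From clique counts to degrees. -/

section Cliques

variable {β : Type*} [DecidableEq β]

theorem choose_le_card_cliquesAt {F : Finset (Finset β)} {ℓ k t : ℕ} (hk : 1 ≤ k) {U W : Finset β}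
    {u : β} (hF : HasAllSubsets F ℓ W) (hWU : W ⊆ U) (hu : u ∈ W) (hW : t + 1 ≤ W.card) :
    t.choose (k - 1) ≤ (cliquesAt F ℓ k U u).card := by
  have h1 : t.choose (k - 1) ≤ ((W.erase u).powersetCard (k - 1)).card := by
    rw [Finset.card_powersetCard, Finset.card_erase_of_mem hu]
    exact Nat.choose_le_choose _ (by omega)
  refine h1.trans (Finset.card_le_card_of_injOn (fun T => insert u T) ?_ ?_)
  · intro T hT
    obtain ⟨hT, hTc⟩ := Finset.mem_powersetCard.1 (Finset.mem_coe.1 hT)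
    have huT : u ∉ T := fun h => by simpa using hT h
    have hins : insert u T ⊆ W := Finset.insert_subset hu (hT.trans (Finset.erase_subset _ _))
    refine mem_cliquesAt.2 ⟨hins.trans hWU, ?_, Finset.mem_insert_self _ _,
      fun e he => hF e (he.trans hins)⟩
    rw [Finset.card_insert_of_notMem huT, hTc]
    omega
  · intro T hT T' hT' h
    have hT := (Finset.mem_powersetCard.1 (Finset.mem_coe.1 hT)).1
    have hT' := (Finset.mem_powersetCard.1 (Finset.mem_coe.1 hT')).1
    have h1 : u ∉ T := fun h => by simpa using hT h
    have h2 : u ∉ T' := fun h => by simpa using hT' h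
    have h : insert u T = insert u T' := h
    rw [← Finset.erase_insert h1, h, Finset.erase_insert h2]

/-- Many cliques at a vertex force a large degree. -/
theorem choose_le_degree {F : Finset (Finset β)} {ℓ k t : ℕ} (hℓ : 1 ≤ ℓ) (hℓk : ℓ ≤ k)
    (hkt : k ≤ t + 1) {U : Finset β} {u : β}
    (h : t.choose (k - 1) ≤ (cliquesAt F ℓ k U u).card) :
    t.choose (ℓ - 1) ≤ (F.filter fun e => u ∈ e).card := by
  -- Removing `u` turns the cliques at `u` into `(k-1)`-sets whose `(ℓ-1)`-subsets all lie in the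
  -- link of `u`.
  refine (choose_le_card_of_shadow (r := k - 1)
    (𝒬 := (cliquesAt F ℓ k U u).image fun S => S.erase u)
    (𝓛 := (F.filter fun e => u ∈ e).image fun e => e.erase u) (by omega) (by omega)
    ?_ ?_ ?_).trans Finset.card_image_le
  · intro S' hS'
    obtain ⟨S, hS, rfl⟩ := Finset.mem_image.1 hS'
    obtain ⟨_, hSk, hu, _⟩ := mem_cliquesAt.1 hS
    rw [Finset.card_erase_of_mem hu, hSk]
  · intro S' hS' T hT hTc
    obtain ⟨S, hS, rfl⟩ := Finset.mem_image.1 hS'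
    obtain ⟨_, hSk, hu, hS⟩ := mem_cliquesAt.1 hS
    have huT : u ∉ T := fun h => by simpa using hT h
    refine Finset.mem_image.2 ⟨insert u T, Finset.mem_filter.2 ⟨hS _ ?_ ?_,
      Finset.mem_insert_self _ _⟩, Finset.erase_insert huT⟩
    · exact Finset.insert_subset hu (hT.trans (Finset.erase_subset _ _))
    · rw [Finset.card_insert_of_notMem huT, hTc]
      omega
  · rwa [Finset.card_image_of_injOn]
    intro S hS S' hS' h
    have h1 := (mem_cliquesAt.1 (Finset.mem_coe.1 hS)).2.2.1
    have h2 := (mem_cliquesAt.1 (Finset.mem_coe.1 hS')).2.2.1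
    have h : S.erase u = S'.erase u := h
    rw [← Finset.insert_erase h1, h, Finset.insert_erase h2]

theorem sum_degree {F : Finset (Finset β)} {U : Finset β} {ℓ : ℕ}
    (hF : ∀ e ∈ F, e ⊆ U ∧ e.card = ℓ) :
    ∑ w ∈ U, (F.filter fun e => w ∈ e).card = ℓ * F.card := by
  simp only [Finset.card_filter]
  rw [Finset.sum_comm, mul_comm, ← smul_eq_mul, ← Finset.sum_const]
  refine Finset.sum_congr rfl fun e he => ?_
  rw [← Finset.card_filter, Finset.filter_mem_eq_inter, Finset.inter_eq_right.2 (hF e he).1,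
    (hF e he).2]

end Cliques

/-! ### Cliques in the auxiliary graph. -/

namespace UGraph

set_option linter.unusedSectionVars false

variable {α : Type*} [DecidableEq α] {ℓ t : ℕ} {G : UGraph α ℓ} {A₁ A₂ : Finset α}
  {v : Fin (t + 1) ↪ α} {xs : List α} {cs : List (Fin (t + 1))}

open Classical in
/-- The sets `S ⊆ A` for which `Y ∪ S` induces a copy of `K_k^ℓ`. -/
noncomputable def cliqueLink (G : UGraph α ℓ) (k : ℕ) (A Y : Finset α) : Finset (Finset α) :=
  (A.powersetCard (k - Y.card)).filter fun S => G.InducesK k (Y ∪ S)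

theorem mem_cliqueLink {k : ℕ} {A Y S : Finset α} :
    S ∈ G.cliqueLink k A Y ↔ S ⊆ A ∧ S.card = k - Y.card ∧ G.InducesK k (Y ∪ S) := by
  simp [cliqueLink, and_assoc]

theorem card_union_le_two_mul (hA₁ : G.InducesK (t + 1) A₁) (hA₂ : G.InducesK (t + 1) A₂) :
    (A₁ ∪ A₂).card ≤ (t + 1) + (t + 1) :=
  (Finset.card_union_le _ _).trans (by rw [hA₁.2.1, hA₂.2.1])

/-- The mixed edges needed to complete `Y` and an early set of labels. -/
theorem mixed_mem_auxEdges (hA₁ : G.InducesK (t + 1) A₁) (hA₂ : G.InducesK (t + 1) A₂) {k : ℕ}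
    {Y Y' : Finset α} (hYA : Disjoint Y (A₁ ∪ A₂)) (hY' : Y' ⊆ Y) (hY'0 : Y'.Nonempty)
    {S T : Finset (Fin ((t + 1) + (t + 1)))}
    (hS : S ∈ smallestSets ((t + 1) + (t + 1)) (k - Y.card) (G.cliqueLink k (A₁ ∪ A₂) Y).card)
    (hT : T ⊆ S) (hT0 : T.Nonempty) (hc : Y'.card + T.card = ℓ) :
    Y'.map Function.Embedding.inl ∪ T.map (label v) ∈ G.auxEdges A₁ A₂ v := by
  have hY'A := hYA.mono_left hY'
  have h1 := Finset.card_pos.2 hY'0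
  have h2 := Finset.card_pos.2 hT0
  have hSc := (mem_smallestSets.1 hS).1
  have hTS := Finset.card_le_card hT
  have hlink : ∀ S₁ ∈ G.cliqueLink k (A₁ ∪ A₂) Y, ∀ T₁ ⊆ S₁, T₁.card = T.card →
      T₁ ∈ G.link Y' (A₁ ∪ A₂) := by
    intro S₁ hS₁ T₁ hT₁ hT₁c
    obtain ⟨hS₁A, _, hS₁k⟩ := mem_cliqueLink.1 hS₁
    refine mem_link.2 ⟨hT₁.trans hS₁A, by omega, hS₁k.mem_edges ?_ ?_⟩
    · exact Finset.union_subset (hT₁.trans Finset.subset_union_right)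
        (hY'.trans Finset.subset_union_left)
    · rw [Finset.card_union_of_disjoint (hY'A.symm.mono_left (hT₁.trans hS₁A))]
      omega
  -- Kruskal–Katona links the two compressions: every `|T|`-subset of a set completing `Y` to a
  -- clique lies in the link of `Y'`.
  have hKK := mem_smallestSets_of_subset (by omega) (card_union_le_two_mul hA₁ hA₂)
    (hTS.trans hSc.le) (fun S₁ hS₁ => ⟨(mem_cliqueLink.1 hS₁).1, (mem_cliqueLink.1 hS₁).2.1⟩)
    hlink hS hT rfl
  refine mem_auxEdges.2 (Or.inr ⟨Y', ?_, h1, by omega, T, ?_, rfl⟩)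
  · obtain ⟨S₁, hS₁⟩ := Finset.card_pos.1 (Nat.zero_lt_of_lt (mem_smallestSets.1 hS).2)
    obtain ⟨T₁, hT₁, hT₁c⟩ := Finset.exists_subset_card_eq
      (show T.card ≤ S₁.card by rw [(mem_cliqueLink.1 hS₁).2.1]; omega)
    obtain ⟨h3, _, h4⟩ := mem_link.1 (hlink S₁ hS₁ T₁ hT₁ hT₁c)
    exact mem_boundary_of_edge h3 (Finset.card_pos.1 (by omega)) hY'A h4
  · rwa [show ℓ - Y'.card = T.card by omega]

theorem map_castAdd_label (hv : Finset.univ.map v = A₁) :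
    (Finset.univ.map (Fin.castAddEmb (t + 1))).map (label v) =
      A₁.map (Function.Embedding.inl : α ↪ α ⊕ Fin (t + 1)) := by
  rw [← hv, Finset.map_map, Finset.map_map]
  congr 1
  ext i : 1
  simp [label_castAdd]

theorem InducesK.hasAllSubsets_auxEdges {s : ℕ} {A : Finset α} (h : G.InducesK s A)
    (hA : A ⊆ A₁ ∨ A ⊆ A₂ ∨ Disjoint A (A₁ ∪ A₂)) :
    HasAllSubsets (G.auxEdges A₁ A₂ v) ℓ (A.map Function.Embedding.inl) := by
  intro e he hec
  obtain ⟨f, hf, rfl⟩ := Finset.subset_map_iff.1 he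
  exact map_inl_mem_auxEdges (h.mem_edges hf (by simpa using hec))
    (hA.imp hf.trans (Or.imp hf.trans fun h => h.mono_left hf))

/-- If too many cliques extend `Y`, then each vertex of `Y` is completely joined to `A₁`. -/
theorem hasAllSubsets_insert (hℓ : 2 ≤ ℓ) (hA₁ : G.InducesK (t + 1) A₁)
    (hA₂ : G.InducesK (t + 1) A₂) (hv : Finset.univ.map v = A₁) {k : ℕ} (hkt : k ≤ t + 1)
    {Y : Finset α} (hYA : Disjoint Y (A₁ ∪ A₂)) {a : α} (ha : a ∈ Y) (hYk : ℓ ≤ k - Y.card)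
    (hY : (t + 1).choose (k - Y.card) < (G.cliqueLink k (A₁ ∪ A₂) Y).card) :
    HasAllSubsets (G.auxEdges A₁ A₂ v) ℓ (insert (Sum.inl a) (A₁.map Function.Embedding.inl)) := by
  intro e he hec
  by_cases hae : Sum.inl a ∈ e
  · have h1 : e.erase (Sum.inl a) ⊆ A₁.map Function.Embedding.inl := by
      exact Finset.subset_insert_iff.1 he
    have h2 : (e.erase (Sum.inl a)).card = ℓ - 1 := by rw [Finset.card_erase_of_mem hae, hec]
    rw [← map_castAdd_label hv] at h1
    obtain ⟨T, hT, hTe⟩ := Finset.subset_map_iff.1 h1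
    have hTc : T.card = ℓ - 1 := by rw [← h2, hTe, Finset.card_map]
    -- `T` is enlarged within the labels of `A₁` to size `k - |Y|`; by `hY`, all such sets are among
    -- the smallest ones.
    obtain ⟨S, hTS, hS, hSc⟩ := Finset.exists_subsuperset_card_eq (n := k - Y.card) hT (by omega)
      (by simp; omega)
    have hS' := mem_smallestSets_of_lt (s := t + 1) hSc (fun i hi => by
      obtain ⟨j, _, rfl⟩ := Finset.mem_map.1 (hS hi)
      have := j.isLt
      simpa using Nat.lt_succ_iff.1 this) hY.le
    have := mixed_mem_auxEdges (v := v) hA₁ hA₂ hYA (Finset.singleton_subset_iff.2 ha)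
      (Finset.singleton_nonempty a) hS' hTS (Finset.card_pos.1 (by omega))
      (by rw [Finset.card_singleton]; omega)
    rwa [← hTe, Finset.map_singleton, Function.Embedding.inl_apply, ← Finset.insert_eq,
      Finset.insert_erase hae] at this
  · exact hA₁.hasAllSubsets_auxEdges (Or.inl subset_rfl) e
      ((Finset.subset_insert_iff_of_notMem hae).1 he) hec

/-- Edges inside `Y` are inherited from a clique of `G`, and mixed edges come from Kruskal–Katona.
Edges inside the label set need `hY`, which forces the labels into `A₁`; if the set has fewer than
`ℓ` labels there are none to check. -/
theorem hasAllSubsets_union_smallest (hA₁ : G.InducesK (t + 1) A₁)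
    (hA₂ : G.InducesK (t + 1) A₂) (hv : Finset.univ.map v = A₁) {k : ℕ}
    {Y : Finset α} (hYA : Disjoint Y (A₁ ∪ A₂))
    (hY : ℓ ≤ k - Y.card → (G.cliqueLink k (A₁ ∪ A₂) Y).card ≤ (t + 1).choose (k - Y.card))
    {S : Finset (Fin ((t + 1) + (t + 1)))}
    (hS : S ∈ smallestSets ((t + 1) + (t + 1)) (k - Y.card) (G.cliqueLink k (A₁ ∪ A₂) Y).card) :
    HasAllSubsets (G.auxEdges A₁ A₂ v) ℓ (Y.map Function.Embedding.inl ∪ S.map (label v)) := by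
  classical
  intro e he hec
  obtain ⟨e₁, e₂, he₁, he₂, rfl⟩ : ∃ e₁ e₂, e₁ ⊆ Y.map Function.Embedding.inl ∧
      e₂ ⊆ S.map (label v) ∧ e₁ ∪ e₂ = e :=
    ⟨e ∩ Y.map Function.Embedding.inl, e ∩ S.map (label v), Finset.inter_subset_right,
      Finset.inter_subset_right, by rw [← Finset.inter_union_distrib_left,
        Finset.inter_eq_left.2 he]⟩
  obtain ⟨Y', hY', rfl⟩ := Finset.subset_map_iff.1 he₁
  obtain ⟨T, hT, rfl⟩ := Finset.subset_map_iff.1 he₂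
  have hdisj : Disjoint (Y'.map Function.Embedding.inl) (T.map (label v)) := by
    rw [Finset.disjoint_left]
    intro b hb hb'
    obtain ⟨y, hy, rfl⟩ := Finset.mem_map.1 hb
    obtain ⟨i, _, hi⟩ := Finset.mem_map.1 hb'
    exact Finset.disjoint_left.1 hYA (hY' hy)
      (Finset.mem_union_left _ (mem_of_label_eq_inl hv hi))
  rw [Finset.card_union_of_disjoint hdisj, Finset.card_map, Finset.card_map] at hec
  rcases T.eq_empty_or_nonempty with rfl | hT0
  · rw [Finset.map_empty, Finset.union_empty]
    obtain ⟨S₁, hS₁⟩ := Finset.card_pos.1 (Nat.zero_lt_of_lt (mem_smallestSets.1 hS).2)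
    refine map_inl_mem_auxEdges ((mem_cliqueLink.1 hS₁).2.2.mem_edges
      (hY'.trans Finset.subset_union_left) (by simpa using hec))
      (Or.inr (Or.inr (hYA.mono_left hY')))
  rcases Y'.eq_empty_or_nonempty with rfl | hY'0
  · rw [Finset.map_empty, Finset.empty_union]
    have hTc : T.card = ℓ := by simpa using hec
    have h1 : ℓ ≤ k - Y.card := by
      rw [← hTc, ← (mem_smallestSets.1 hS).1]
      exact Finset.card_le_card hT
    have h2 := lt_of_mem_smallestSets (s := t + 1) (by omega) hS (hY h1)
    refine hA₁.hasAllSubsets_auxEdges (Or.inl subset_rfl) _ ?_ (by simpa using hTc)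
    rw [← map_castAdd_label hv, Finset.map_subset_map]
    intro i hi
    refine Finset.mem_map.2 ⟨⟨i.val, h2 i (hT hi)⟩, Finset.mem_univ _, ?_⟩
    ext; simp
  · exact mixed_mem_auxEdges hA₁ hA₂ hYA hY' hY'0 hS hT hT0 hec

/-- Both sides are counted by the trace on `V \ A`. For each trace `Y`, the sets completing `Y` to
cliques are replaced by equally many smallest label sets. -/
theorem numCopies_le_card_cliquesAt (hA₁ : G.InducesK (t + 1) A₁)
    (hA₂ : G.InducesK (t + 1) A₂) (hv : Finset.univ.map v = A₁) {k : ℕ} {a : α}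
    (haA : a ∉ A₁ ∪ A₂)
    (hgood : ∀ Y, Disjoint Y (A₁ ∪ A₂) → a ∈ Y → ℓ ≤ k - Y.card →
      (G.cliqueLink k (A₁ ∪ A₂) Y).card ≤ (t + 1).choose (k - Y.card)) :
    G.numCopies k a ≤
      (cliquesAt (G.auxEdges A₁ A₂ v) ℓ k (G.verts.disjSum Finset.univ) (Sum.inl a)).card := by
  classical
  set A := A₁ ∪ A₂ with hA
  set 𝒴 := (G.verts \ A).powerset with h𝒴
  set K := G.verts.powerset.filter fun S => a ∈ S ∧ G.InducesK k S with hK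
  set K' := cliquesAt (G.auxEdges A₁ A₂ v) ℓ k (G.verts.disjSum Finset.univ) (Sum.inl a) with hK'
  let π : Finset (α ⊕ Fin (t + 1)) → Finset α := fun E =>
    (G.verts \ A).filter fun x => Sum.inl x ∈ E
  have h1 : G.numCopies k a = K.card := by
    unfold numCopies
    congr 1
  have h2 : K.card = ∑ Y ∈ 𝒴, (K.filter fun S => S \ A = Y).card :=
    Finset.card_eq_sum_card_fiberwise fun S hS => by
      simp only [hK, Finset.coe_filter, Set.mem_ofPred_eq, Finset.mem_powerset] at hS
      exact Finset.mem_coe.2 (Finset.mem_powerset.2 (Finset.sdiff_subset_sdiff hS.1 subset_rfl))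
  have h3 : K'.card = ∑ Y ∈ 𝒴, (K'.filter fun E => π E = Y).card :=
    Finset.card_eq_sum_card_fiberwise fun E _ =>
      Finset.mem_coe.2 (Finset.mem_powerset.2 (Finset.filter_subset _ _))
  rw [h1, h2, h3]
  refine Finset.sum_le_sum fun Y hY => ?_
  have hYs := Finset.mem_powerset.1 hY
  have hYA : Disjoint Y A := Finset.sdiff_disjoint.mono_left hYs
  rcases (K.filter fun S => S \ A = Y).eq_empty_or_nonempty with h0 | ⟨S₀, hS₀⟩
  · rw [h0]; simp
  have hKm : ∀ S ∈ K.filter (fun S => S \ A = Y), a ∈ S ∧ G.InducesK k S ∧ S \ A = Y := by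
    intro S hS
    simp only [hK, Finset.mem_filter] at hS
    exact ⟨hS.1.2.1, hS.1.2.2, hS.2⟩
  have haY : a ∈ Y := by
    obtain ⟨h4, _, h5⟩ := hKm S₀ hS₀
    rw [← h5]
    exact Finset.mem_sdiff.2 ⟨h4, haA⟩
  have hYk : Y.card ≤ k := by
    obtain ⟨_, h4, h5⟩ := hKm S₀ hS₀
    rw [← h5, ← h4.2.1]
    exact Finset.card_le_card Finset.sdiff_subset
  set m := (G.cliqueLink k A Y).card with hm
  have h4 : (K.filter fun S => S \ A = Y).card ≤ m := by
    refine Finset.card_le_card_of_injOn (fun S => S ∩ A) ?_ ?_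
    · intro S hS
      obtain ⟨_, h5, h6⟩ := hKm S hS
      refine mem_cliqueLink.2 ⟨Finset.inter_subset_right, ?_, ?_⟩
      · have := Finset.card_sdiff_add_card_inter S A
        rw [h6, h5.2.1] at this
        change (S ∩ A).card = _
        omega
      · rwa [← h6, Finset.sdiff_union_inter]
    · intro S hS S' hS' h
      have h : S ∩ A = S' ∩ A := h
      rw [← Finset.sdiff_union_inter S A, ← Finset.sdiff_union_inter S' A, h, (hKm S hS).2.2,
        (hKm S' hS').2.2]
  -- There are enough label sets since `|A| ≤ 2(t+1)`; hence the choice of `|C| = t + 1`.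
  have h5 : m = (smallestSets ((t + 1) + (t + 1)) (k - Y.card) m).card := by
    rw [card_smallestSets, min_eq_left]
    refine (Finset.card_filter_le _ _).trans ?_
    rw [Finset.card_powersetCard]
    exact Nat.choose_le_choose _ (card_union_le_two_mul hA₁ hA₂)
  refine h4.trans (h5.le.trans ?_)
  have hlab : ∀ (S : Finset (Fin ((t + 1) + (t + 1)))) (x : α), x ∉ A →
      (Sum.inl x ∈ Y.map (Function.Embedding.inl : α ↪ α ⊕ Fin (t + 1)) ∪ S.map (label v) ↔
        x ∈ Y) := by
    intro S x hx
    rw [Finset.mem_union]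
    constructor
    · rintro (h | h)
      · simpa using h
      · obtain ⟨i, _, hi⟩ := Finset.mem_map.1 h
        exact absurd (Finset.mem_union_left _ (mem_of_label_eq_inl hv hi)) hx
    · intro h
      exact Or.inl (by simpa using h)
  have hdisj : ∀ S : Finset (Fin ((t + 1) + (t + 1))),
      Disjoint (Y.map (Function.Embedding.inl : α ↪ α ⊕ Fin (t + 1))) (S.map (label v)) := by
    intro S
    rw [Finset.disjoint_left]
    intro b hb hb'
    obtain ⟨y, hy, rfl⟩ := Finset.mem_map.1 hb
    obtain ⟨i, _, hi⟩ := Finset.mem_map.1 hb'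
    exact Finset.disjoint_left.1 hYA hy (Finset.mem_union_left _ (mem_of_label_eq_inl hv hi))
  refine Finset.card_le_card_of_injOn
    (fun S => Y.map Function.Embedding.inl ∪ S.map (label v)) ?_ ?_
  · intro S hS
    refine Finset.mem_coe.2 (Finset.mem_filter.2 ⟨mem_cliquesAt.2 ⟨?_, ?_, ?_, ?_⟩, ?_⟩)
    · refine Finset.union_subset ?_ ?_
      · intro b hb
        obtain ⟨y, hy, rfl⟩ := Finset.mem_map.1 hb
        exact Finset.inl_mem_disjSum.2 (Finset.mem_sdiff.1 (hYs hy)).1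
      · intro b hb
        obtain ⟨i, _, rfl⟩ := Finset.mem_map.1 hb
        rcases h : label v i with x | c
        · exact Finset.inl_mem_disjSum.2 (hA₁.1 (mem_of_label_eq_inl hv h))
        · exact Finset.inr_mem_disjSum.2 (Finset.mem_univ c)
    · rw [Finset.card_union_of_disjoint (hdisj S), Finset.card_map, Finset.card_map,
        (mem_smallestSets.1 (Finset.mem_coe.1 hS)).1]
      omega
    · exact (hlab S a haA).2 haY
    · exact hasAllSubsets_union_smallest hA₁ hA₂ hv hYA (hgood Y hYA haY) (Finset.mem_coe.1 hS)
    · ext x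
      simp only [π, Finset.mem_filter]
      constructor
      · rintro ⟨h6, h7⟩
        exact (hlab S x (Finset.mem_sdiff.1 h6).2).1 h7
      · intro h6
        exact ⟨hYs h6, (hlab S x (Finset.mem_sdiff.1 (hYs h6)).2).2 h6⟩
  · intro S _ S' _ h
    have h : Y.map Function.Embedding.inl ∪ S.map (label v) =
        Y.map Function.Embedding.inl ∪ S'.map (label v) := h
    apply Finset.map_injective (label v)
    rw [← Finset.union_sdiff_cancel_left (hdisj S), h, Finset.union_sdiff_cancel_left (hdisj S')]

theorem choose_le_cliquesAt_auxEdges (hℓ : 2 ≤ ℓ) {k : ℕ} (hk : ℓ < k) (hkt : k ≤ t)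
    (hG : G.CliqueCondition k t) (hA₁ : G.InducesK (t + 1) A₁) (hA₂ : G.InducesK (t + 1) A₂)
    (hv : Finset.univ.map v = A₁) {a : α} (ha : a ∈ G.verts) :
    t.choose (k - 1) ≤
      (cliquesAt (G.auxEdges A₁ A₂ v) ℓ k (G.verts.disjSum Finset.univ) (Sum.inl a)).card := by
  have hsub : ∀ A ⊆ G.verts, A.map Function.Embedding.inl ⊆
      G.verts.disjSum (Finset.univ : Finset (Fin (t + 1))) := by
    intro A hA b hb
    obtain ⟨y, hy, rfl⟩ := Finset.mem_map.1 hb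
    exact Finset.inl_mem_disjSum.2 (hA hy)
  by_cases haA : a ∈ A₁ ∪ A₂
  · rcases Finset.mem_union.1 haA with h | h
    · exact choose_le_card_cliquesAt (by omega)
        (hA₁.hasAllSubsets_auxEdges (Or.inl subset_rfl)) (hsub _ hA₁.1) (by simpa using h)
        (by rw [Finset.card_map, hA₁.2.1])
    · exact choose_le_card_cliquesAt (by omega)
        (hA₂.hasAllSubsets_auxEdges (Or.inr (Or.inl subset_rfl))) (hsub _ hA₂.1)
        (by simpa using h) (by rw [Finset.card_map, hA₂.2.1])
  by_cases hgood : ∀ Y, Disjoint Y (A₁ ∪ A₂) → a ∈ Y → ℓ ≤ k - Y.card →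
      (G.cliqueLink k (A₁ ∪ A₂) Y).card ≤ (t + 1).choose (k - Y.card)
  · exact (hG a ha).trans (numCopies_le_card_cliquesAt hA₁ hA₂ hv haA hgood)
  · push Not at hgood
    obtain ⟨Y, hYA, haY, hYk, hY⟩ := hgood
    refine choose_le_card_cliquesAt (by omega)
      (hasAllSubsets_insert hℓ hA₁ hA₂ hv (by omega) hYA haY hYk hY)
      (Finset.insert_subset (Finset.inl_mem_disjSum.2 ha) (hsub _ hA₁.1))
      (Finset.mem_insert_self _ _) ?_
    refine le_trans ?_ (Finset.card_le_card (Finset.subset_insert _ _))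
    rw [Finset.card_map, hA₁.2.1]

/-! ### After shifting, no edge meets `C`. -/

theorem card_cliquesAt_le_shiftedEdges (k : ℕ) (hxs : ∀ x ∈ xs, x ∈ G.verts) (a : α) :
    (cliquesAt (G.auxEdges A₁ A₂ v) ℓ k (G.verts.disjSum Finset.univ) (Sum.inl a)).card ≤
      (cliquesAt (G.shiftedEdges A₁ A₂ v xs cs) ℓ k (G.verts.disjSum Finset.univ)
        (Sum.inl a)).card :=
  foldl_shiftInto_induction (P := fun F =>
    (cliquesAt (G.auxEdges A₁ A₂ v) ℓ k (G.verts.disjSum Finset.univ) (Sum.inl a)).card ≤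
      (cliquesAt F ℓ k (G.verts.disjSum Finset.univ) (Sum.inl a)).card) cs xs
    (fun F hF x hx c => hF.trans (card_cliquesAt_le_shiftFamily F ℓ k (by simp) (by simp)
      (Finset.inl_mem_disjSum.2 (hxs x hx)))) le_rfl

theorem subset_disjSum_of_mem_shiftedEdges (hA₁ : G.InducesK (t + 1) A₁)
    (hv : Finset.univ.map v = A₁) (hxs : ∀ x ∈ xs, x ∈ G.verts) :
    ∀ E ∈ G.shiftedEdges A₁ A₂ v xs cs, E ⊆ G.verts.disjSum Finset.univ ∧ E.card = ℓ := by
  refine foldl_shiftInto_induction (P := fun F => ∀ E ∈ F,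
    E ⊆ G.verts.disjSum Finset.univ ∧ E.card = ℓ) cs xs ?_ ?_
  · intro F hF x hx c E hE
    rcases (mem_shiftFamily (by simp)).1 hE with ⟨h, _⟩ | ⟨h1, h2, h3⟩
    · exact hF E h
    · have h4 := hF _ h3
      refine ⟨fun b hb => ?_, by rw [← h4.2, card_replace h1 h2]⟩
      by_cases hbx : b = Sum.inl x
      · rw [hbx]; exact Finset.inl_mem_disjSum.2 (hxs x hx)
      · exact h4.1 (by simp [hb, hbx])
  · intro E hE
    refine ⟨fun b hb => ?_, card_of_mem_auxEdges hv hE⟩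
    rcases b with x | c
    · refine Finset.inl_mem_disjSum.2 ?_
      rcases mem_auxEdges.1 hE with ⟨e, he, _, rfl⟩ | ⟨Y, hY, _, _, S, _, rfl⟩
      · exact G.subset_verts e he (by simpa using hb)
      · rcases Finset.mem_union.1 hb with h | h
        · exact (mem_boundary.1 (hY (by simpa using h))).1
        · obtain ⟨i, _, hi⟩ := Finset.mem_map.1 h
          exact hA₁.1 (mem_of_label_eq_inl hv hi)
    · exact Finset.inr_mem_disjSum.2 (Finset.mem_univ c)

/-- A vertex which lies in a surviving edge meeting `C` has a large degree. -/
theorem le_degree_of_inr_mem (hxs : Enumerates xs (G.verts \ (A₂ \ A₁)))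
    (hcs : Enumerates cs Finset.univ) (hA₂ : A₂.card = t + 1)
    {f : Finset (α ⊕ Fin (t + 1))} {c : Fin (t + 1)} (hc : Sum.inr c ∉ f)
    (hf : insert (Sum.inr c) f ∈ G.shiftedEdges A₁ A₂ v xs cs) {w : α ⊕ Fin (t + 1)} (hw : w ∈ f) :
    G.verts.card + 1 ≤
      ((G.shiftedEdges A₁ A₂ v xs cs).filter fun e => w ∈ e).card + (t + 1) + f.card := by
  set X := (G.verts \ (A₂ \ A₁)).map (Function.Embedding.inl : α ↪ α ⊕ Fin (t + 1)) \ f with hX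
  have h1 : G.verts.card ≤ X.card + (t + 1) + f.card := by
    have h2 := Finset.le_card_sdiff f
      ((G.verts \ (A₂ \ A₁)).map (Function.Embedding.inl : α ↪ α ⊕ Fin (t + 1)))
    have h3 := Finset.le_card_sdiff (A₂ \ A₁) G.verts
    have h4 : (A₂ \ A₁).card ≤ t + 1 := hA₂ ▸ Finset.card_le_card Finset.sdiff_subset
    rw [← hX, Finset.card_map] at h2
    omega
  have hcX : Sum.inr c ∉ X := by simp [hX]
  -- Each `x ∈ X` may take the place of `c`, giving distinct edges through `w`; `c` itself accounts
  -- for one more.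
  have h2 : (insert (Sum.inr c) X).card ≤
      ((G.shiftedEdges A₁ A₂ v xs cs).filter fun e => w ∈ e).card := by
    have hnot : ∀ z ∈ insert (Sum.inr c) X, z ∉ f := by
      intro z hz
      rcases Finset.mem_insert.1 hz with rfl | hz
      · exact hc
      · exact (Finset.mem_sdiff.1 hz).2
    refine Finset.card_le_card_of_injOn (fun z => insert z f) ?_ ?_
    · intro z hz
      refine Finset.mem_coe.2 (Finset.mem_filter.2 ⟨?_, Finset.mem_insert_of_mem hw⟩)
      rcases Finset.mem_insert.1 (Finset.mem_coe.1 hz) with rfl | hzX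
      · exact hf
      · obtain ⟨hz1, hz2⟩ := Finset.mem_sdiff.1 hzX
        obtain ⟨x, hx, rfl⟩ := Finset.mem_map.1 hz1
        exact closedUnder_foldl_shiftInto cs xs _ ((hxs.2 x).2 hx)
          ((hcs.2 c).2 (Finset.mem_univ c)) f hz2 hc hf
    · intro z hz z' hz' h
      have h : insert z f = insert z' f := h
      have : z ∈ insert z' f := h ▸ Finset.mem_insert_self z f
      exact (Finset.mem_insert.1 this).resolve_right (hnot z hz)
  rw [Finset.card_insert_of_notMem hcX] at h2
  omega

/-- Double counting of degrees: an edge through `c` makes its other `ℓ - 1` vertices exceed the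
minimum degree by more than the total excess allowed by extremality. -/
theorem inr_notMem_of_mem_shiftedEdges (hℓ : 2 ≤ ℓ) {k n : ℕ} (hk : ℓ < k) (hkt : k ≤ t)
    (hG : G.IsExtremal k t n) (hA₁ : G.InducesK (t + 1) A₁) (hA₂ : G.InducesK (t + 1) A₂)
    (hv : Finset.univ.map v = A₁) (hxs : Enumerates xs (G.verts \ (A₂ \ A₁)))
    (hcs : Enumerates cs Finset.univ)
    (hn : (t + 1) ^ 2 * (t - 1).choose (ℓ - 2) + 8 * t < 4 * n)
    {E : Finset (α ⊕ Fin (t + 1))} (hE : E ∈ G.shiftedEdges A₁ A₂ v xs cs) (c : Fin (t + 1)) :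
    Sum.inr c ∉ E := by
  intro hcE
  have hxsV : ∀ x ∈ xs, x ∈ G.verts := fun x hx => (Finset.mem_sdiff.1 ((hxs.2 x).1 hx)).1
  set F := G.shiftedEdges A₁ A₂ v xs cs with hF
  set U := G.verts.disjSum (Finset.univ : Finset (Fin (t + 1))) with hU
  have hFU := subset_disjSum_of_mem_shiftedEdges (A₂ := A₂) (cs := cs) hA₁ hv hxsV
  set deg : α ⊕ Fin (t + 1) → ℕ := fun w => (F.filter fun e => w ∈ e).card with hdeg
  have hsum : ∑ w ∈ U, deg w = ℓ * F.card := sum_degree hFU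
  have hFE : F.card ≤ G.edges.card := card_shiftedEdges.le.trans card_auxEdges_le
  have hext := hG.edges_le hℓ (by omega) (by omega)
  set d := t.choose (ℓ - 1) with hd
  have hdegV : ∀ a ∈ G.verts, d ≤ deg (Sum.inl a) := fun a ha =>
    choose_le_degree (by omega) hk.le (by omega)
      ((choose_le_cliquesAt_auxEdges hℓ hk hkt hG.2.1 hA₁ hA₂ hv ha).trans
        (card_cliquesAt_le_shiftedEdges k hxsV a))
  set f := E.erase (Sum.inr c) with hf
  have hfc : f.card = ℓ - 1 := by rw [Finset.card_erase_of_mem hcE, (hFU E hE).2]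
  have hcf : Sum.inr c ∉ f := Finset.notMem_erase _ _
  have hins : insert (Sum.inr c) f = E := Finset.insert_erase hcE
  -- Excess over the guaranteed degree: `d` on `V`, zero on `C`. It is integer-valued to avoid
  -- truncated subtraction.
  let exc : α ⊕ Fin (t + 1) → ℤ := fun w => deg w - Sum.elim (fun _ => (d : ℤ)) (fun _ => 0) w
  have hexc_sum : ∑ w ∈ U, exc w = ℓ * F.card - n * d := by
    rw [Finset.sum_sub_distrib, ← Nat.cast_sum, hsum, hU, Finset.sum_disjSum]
    simp [hG.1]
  have hexc0 : ∀ w ∈ U, 0 ≤ exc w := by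
    intro w hw
    rcases w with a | c'
    · have := hdegV a (Finset.inl_mem_disjSum.1 hw)
      simp only [exc, Sum.elim_inl]
      omega
    · simp only [exc, Sum.elim_inr]
      omega
  have hexcf : ∀ w ∈ f, (n : ℤ) - t - ℓ + 1 - d ≤ exc w := by
    intro w hw
    have h1 := le_degree_of_inr_mem hxs hcs hA₂.2.1 hcf (hins.symm ▸ hE) hw
    change G.verts.card + 1 ≤ deg w + _ + _ at h1
    rw [hG.1, hfc] at h1
    have h2 : Sum.elim (fun _ => (d : ℤ)) (fun _ => 0) w ≤ (d : ℤ) := by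
      rcases w with a | c' <;> simp
    simp only [exc]
    omega
  have hexcc : 1 ≤ exc (Sum.inr c) := by
    have : 0 < deg (Sum.inr c) := Finset.card_pos.2 ⟨E, Finset.mem_filter.2 ⟨hE, hcE⟩⟩
    simp only [exc, Sum.elim_inr]
    omega
  have hlow : 1 + ((ℓ : ℤ) - 1) * ((n : ℤ) - t - ℓ + 1 - d) ≤ ∑ w ∈ U, exc w := by
    have h1 : ∑ w ∈ E, exc w ≤ ∑ w ∈ U, exc w :=
      Finset.sum_le_sum_of_subset_of_nonneg (hFU E hE).1 fun w hw _ => hexc0 w hw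
    rw [← hins, Finset.sum_insert hcf] at h1
    have h2 := Finset.card_nsmul_le_sum f exc _ hexcf
    rw [hfc, nsmul_eq_mul, Nat.cast_sub (by omega), Nat.cast_one] at h2
    linarith
  rw [hexc_sum] at hlow
  have hup : 4 * ((ℓ : ℤ) * F.card) ≤
      4 * (n * d) + ((t : ℤ) + 1) ^ 2 * ((t - 1).choose (ℓ - 2) : ℕ) := by
    have : 4 * (ℓ * F.card) ≤ 4 * (n * d) + (t + 1) ^ 2 * (t - 1).choose (ℓ - 2) :=
      le_trans (by gcongr) hext
    exact_mod_cast this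
  have hn' : ((t : ℤ) + 1) ^ 2 * ((t - 1).choose (ℓ - 2) : ℕ) + 8 * t < 4 * n := by
    exact_mod_cast hn
  -- For `ℓ = 2` the lower bound is exactly `n - 2t`, including the unit contributed by `c`, so the
  -- hypothesis on `n` contradicts it directly. For `ℓ ≥ 3` at least two vertices have large excess,
  -- and `d` must first be bounded.
  rcases hℓ.eq_or_lt with h2 | h3
  · subst h2
    have hdt : d = t := by simp [hd]
    rw [hdt] at hlow hup
    push_cast at *
    linarith
  · obtain ⟨b, rfl⟩ : ∃ b, ℓ = b + 3 := ⟨ℓ - 3, by omega⟩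
    obtain ⟨s, rfl⟩ : ∃ s, t = s + 1 := ⟨t - 1, by omega⟩
    have hmul := Nat.add_one_mul_choose_eq s (b + 1)
    simp only [show b + 3 - 1 = b + 2 from rfl, show b + 3 - 2 = b + 1 from rfl,
      Nat.add_sub_cancel, show b + 1 + 1 = b + 2 from rfl] at *
    rw [← hd] at hmul
    have hbs : b + 3 ≤ s := by omega
    generalize s.choose (b + 1) = C at *
    zify at hmul hbs
    push_cast at *
    have hd0 : (0 : ℤ) ≤ d := by positivity
    have hC0 : (0 : ℤ) ≤ C := by positivity
    have hb0 : (0 : ℤ) ≤ b := by positivity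
    have h2d : 2 * (d : ℤ) ≤ (s + 1) * C := by nlinarith
    -- Here `(s+2)² - 4(s+1) = s²`; combined with `hn'` this gives `n > 2d + 2t`.
    have h8d : 8 * (d : ℤ) ≤ ((s : ℤ) + 1 + 1) ^ 2 * C := by
      nlinarith [mul_nonneg (sq_nonneg (s : ℤ)) hC0]
    have hpos : 0 ≤ (n : ℤ) - (s + 1) - (b + 3) + 1 - d := by linarith
    have hbm := mul_nonneg hb0 hpos
    nlinarith

theorem transform_cliqueCondition (hℓ : 2 ≤ ℓ) {k n : ℕ} (hk : ℓ < k) (hkt : k ≤ t)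
    (hG : G.IsExtremal k t n) (hA₁ : G.InducesK (t + 1) A₁) (hA₂ : G.InducesK (t + 1) A₂)
    (hv : Finset.univ.map v = A₁) (hxs : Enumerates xs (G.verts \ (A₂ \ A₁)))
    (hcs : Enumerates cs Finset.univ)
    (hn : (t + 1) ^ 2 * (t - 1).choose (ℓ - 2) + 8 * t < 4 * n) :
    (G.transform A₁ A₂ v xs cs).CliqueCondition k t := by
  classical
  intro a ha
  have ha : a ∈ G.verts := ha
  have hxsV : ∀ x ∈ xs, x ∈ G.verts := fun x hx => (Finset.mem_sdiff.1 ((hxs.2 x).1 hx)).1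
  refine (choose_le_cliquesAt_auxEdges hℓ hk hkt hG.2.1 hA₁ hA₂ hv ha).trans
    ((card_cliquesAt_le_shiftedEdges (cs := cs) k hxsV a).trans ?_)
  unfold numCopies
  refine (Finset.card_le_card fun S hS => ?_).trans (Finset.card_image_le
    (f := fun S : Finset α => S.map (Function.Embedding.inl : α ↪ α ⊕ Fin (t + 1))))
  obtain ⟨hSU, hSk, haS, hS⟩ := mem_cliquesAt.1 hS
  have hsub : S ⊆ G.verts.map Function.Embedding.inl := by
    intro b hb
    rcases b with x | c
    · simpa using hSU hb
    -- As `ℓ ≤ k`, a clique through `c` would contain an edge through `c`.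
    · obtain ⟨e, hce, he, hec⟩ := Finset.exists_subsuperset_card_eq (n := ℓ)
        (Finset.singleton_subset_iff.2 hb) (by simp; omega) (by omega)
      exact absurd (hce (Finset.mem_singleton_self _))
        (inr_notMem_of_mem_shiftedEdges hℓ hk hkt hG hA₁ hA₂ hv hxs hcs hn (hS e he hec) c)
  obtain ⟨S', hS', rfl⟩ := Finset.subset_map_iff.1 hsub
  refine Finset.mem_image.2 ⟨S', Finset.mem_filter.2 ⟨Finset.mem_powerset.2 hS',
    by simpa using haS, hS', by simpa using hSk, fun e he => ?_⟩, rfl⟩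
  obtain ⟨he, hec⟩ := Finset.mem_powersetCard.1 he
  exact mem_transform_edges.2 ⟨⟨he.trans hS', hec⟩,
    hS _ (Finset.map_subset_map.2 he) (by simpa using hec)⟩

end UGraph

/-! ### The lemma. -/

theorem mainTheorem3 (k ℓ : ℕ) (hℓ : 2 ≤ ℓ) (hk : ℓ < k) :
    ∃ t₀ : ℕ, ∀ (t n : ℕ) (α : Type*) [DecidableEq α] (G : UGraph α ℓ),
      G.IsExtremal k t n →
      ∀ A₁ A₂ : Finset α, G.InducesK (t + 1) A₁ → G.InducesK (t + 1) A₂ →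
      ∀ v : Fin (t + 1) ↪ α, Finset.univ.map v = A₁ →
      ∀ (xs : List α) (cs : List (Fin (t + 1))),
        Enumerates xs (G.verts \ (A₂ \ A₁)) → Enumerates cs Finset.univ →
        -- (1) the vertex set is preserved
        (G.transform A₁ A₂ v xs cs).verts = G.verts ∧
        -- (2) the number of edges does not increase
        (G.transform A₁ A₂ v xs cs).edges.card ≤ G.edges.card ∧
        -- (3) edge confinement
        ((G.transform A₁ A₂ v xs cs).InducesK (t + 1) A₁ ∧
          (G.transform A₁ A₂ v xs cs).InducesK (t + 1) A₂ ∧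
          ∀ e ∈ (G.transform A₁ A₂ v xs cs).edges, (e ∩ (A₂ \ A₁)).Nonempty → e ⊆ A₂) ∧
        -- (4) clique shifting
        (∀ A₃ : Finset α, G.InducesK (t + 1) A₃ →
          (G.transform A₁ A₂ v xs cs).InducesK (t + 1)
            ((A₃ \ (A₁ ∪ A₂)) ∪ firstVertices v (A₃ ∩ (A₁ ∪ A₂)).card)) ∧
        -- (5) the clique condition is maintained
        (t₀ ≤ t →
          (1 / 4 : ℝ) * ((t : ℝ) + 1) ^ 2 * ((t - 1).choose (ℓ - 2) : ℝ) + 2 * (t : ℝ) < (n : ℝ) →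
          (G.transform A₁ A₂ v xs cs).CliqueCondition k t) := by
  -- The threshold `t₀ = k` suffices: claim (5) needs of `t` only that `k ≤ t`.
  refine ⟨k, fun t n α _ G hG A₁ A₂ hA₁ hA₂ v hv xs cs hxs hcs => ⟨rfl,
    UGraph.card_transform_edges_le, ⟨?_, ?_, ?_⟩, ?_, ?_⟩⟩
  · exact UGraph.inducesK_transform hA₁.1 hA₁.2.1 fun e he hec =>
      UGraph.map_inl_mem_auxEdges (hA₁.mem_edges he hec) (Or.inl he)
  · exact UGraph.inducesK_transform hA₂.1 hA₂.2.1 fun e he hec =>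
      UGraph.map_inl_mem_auxEdges (hA₂.mem_edges he hec) (Or.inr (Or.inl he))
  · exact fun e he hne => UGraph.subset_of_mem_transform_edges hv
      (fun x hx => (Finset.mem_sdiff.1 ((hxs.2 x).1 hx)).2) he hne
  · exact fun A₃ hA₃ => hA₁.transform_union_firstVertices hv hA₃
  · intro ht hn
    refine UGraph.transform_cliqueCondition hℓ hk ht hG hA₁ hA₂ hv hxs hcs ?_
    have : (((t + 1) ^ 2 * (t - 1).choose (ℓ - 2) + 8 * t : ℕ) : ℝ) < ((4 * n : ℕ) : ℝ) := by
      push_cast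
      linarith
    exact_mod_cast this
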